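/- Order $\mathbb{C}$ coordinatewise: $a+ib\le c+id$ (with $a,b,c,d\in\mathbb{R}$) if and only if $a\le c$ and $b\le d$. Let $\zeta$ be the Riemann zeta function and let $$Z=\{s\in\mathbb{C} : 0\le s,\ \zeta(s)=0\},$$ with the partial order inherited from $(\mathbb{C},\le)$; that is, $Z$ is the set of zeros of $\zeta$ with non-negative real part and non-negative imaginary part. Then the Riemann hypothesis (every zero of $\zeta$ other than $-2,-4,-6,\dots$ has real part $\tfrac12$) is false if and only if $(Z,\le)$ has at least two minimal elements. -/

import Mathlib

/-- The coordinatewise partial order on `ℂ`: `a + ib ≤ c + id` if and only if `a ≤ c` and `b ≤ d`.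
(This is not the order of the scope `ComplexOrder`, under which numbers with different imaginary
parts are incomparable.) -/
@[reducible]
def coordOrder : PartialOrder ℂ where
  le z w := z.re ≤ w.re ∧ z.im ≤ w.im
  le_refl _ := ⟨le_rfl, le_rfl⟩
  le_trans _ _ _ h₁ h₂ := ⟨h₁.1.trans h₂.1, h₁.2.trans h₂.2⟩
  le_antisymm _ _ h₁ h₂ := Complex.ext (h₁.1.antisymm h₂.1) (h₁.2.antisymm h₂.2)

section

attribute [local instance] coordOrder

/-- The set `Z = {s ∈ ℂ : 0 ≤ s, ζ(s) = 0}`, where `≤` is the coordinatewise order. -/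
def zetaZeros : Set ℂ := {s | 0 ≤ s ∧ riemannZeta s = 0}

/-- The set `Min(Z, ≤)` of minimal elements of `Z` for the coordinatewise order. -/
def minimalZetaZeros : Set ℂ := {s | Minimal (fun z => z ∈ zetaZeros) s}

end

open Complex Metric Filter Topology

/-! If the Riemann hypothesis holds, every element of Z has real part 1/2, so Z is a chain and has
at most one minimal element. If it fails, the symmetries s ↦ 1 - s and conjugation give a point of Z
to the left of the critical line. Bounded regions contain finitely many zeros, so some minimal m
lies below that point, and Re m < 1/2. There is also a zero 1/2 + it with 0 ≤ t ≤ 14.6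
(`exists_doubleXi_eq_zero`), hence a minimal k with Im k ≤ 14.6. Then m ≠ k, because every zero off
the line has height above 14.6 (`lt_abs_im_of_doubleXi_eq_zero`).

For this last fact, let f(z²) = 2ξ(1/2 + z) (`xiSq`), an entire function of growth exp(o(|v|)).
Hadamard's product suggests f(c) f(-c) / f(0)² = ∏ (1 - c²/w²) over the zeros w of f;
`norm_mul_norm_neg_le_of_zeros` extracts the needed inequality without infinite products. Take c =
(15/2)², so that f(c) = 2ξ(8) and f(-c) = 2ξ(1/2 + 15i/2). Every factor has modulus at most 1, since
the zeros w are far from 0 and close to the negative axis. A zero off the line of height at most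
14.6 would give two distinct conjugate w, whose factors have product at most 0.8672 in modulus. But
0 < f(0) ≤ 1, f(c) has modulus at least 3.449 and f(-c) ≥ 0.2518, which is a contradiction.

The estimates in the critical strip rest on Λ₀(s) = M(s/2) + M((1-s)/2), where M(s) is the integral
of x^(s-1) ψ(x) over (1, ∞) (`completedRiemannZeta₀_eq_thetaMellin`). On the critical line M is
approximated by finite sums with rational terms. -/

/-! ### Splitting off zeros of entire functions of small growth -/

/-- An entire function with a zero at `w ≠ 0` is divisible by the factor `1 - z / w`. -/
theorem exists_differentiable_eq_one_sub_div_mul {g : ℂ → ℂ} (hg : Differentiable ℂ g) {w : ℂ}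
    (hw : w ≠ 0) (h0 : g w = 0) :
    ∃ k : ℂ → ℂ, Differentiable ℂ k ∧ ∀ z, g z = (1 - z / w) * k z := by
  refine ⟨fun z => -w * dslope g w z, ?_, fun z => ?_⟩
  · have : Differentiable ℂ (dslope g w) := by
      rw [← differentiableOn_univ] at hg ⊢
      exact (Complex.differentiableOn_dslope univ_mem).2 hg
    exact this.const_mul _
  · have h := sub_smul_dslope g w z
    rw [h0, sub_zero, smul_eq_mul] at h
    rw [← h]
    field_simp
    ring

/-- Factors `1 - z / w` with `‖w‖ ≤ R` have norm at least one on the circle of radius `2 * R`. -/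
theorem one_le_norm_one_sub_div {w z : ℂ} {R : ℝ} (hw : w ≠ 0) (hwR : ‖w‖ ≤ R)
    (hz : 2 * R ≤ ‖z‖) : 1 ≤ ‖1 - z / w‖ := by
  have h1 : 2 ≤ ‖z / w‖ := by
    rw [norm_div, le_div_iff₀ (norm_pos_iff.2 hw)]
    linarith
  have h2 := norm_sub_norm_le (z / w) 1
  rw [norm_one, norm_sub_rev] at h2
  linarith

/-- Each factor has modulus at least 3 - 1 on this circle. The exponential gain limits how many
zeros can be split off. -/
theorem two_pow_le_norm_prod {R : ℝ} {z : ℂ} (hz : ‖z‖ = 3 * R) (s : Multiset ℂ)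
    (hs : ∀ w ∈ s, w ≠ 0 ∧ ‖w‖ ≤ R) :
    (2 : ℝ) ^ s.card ≤ ‖(s.map fun w => 1 - z / w).prod‖ := by
  induction s using Multiset.induction_on with
  | empty => simp
  | cons a s ih =>
    rw [Multiset.card_cons, Multiset.map_cons, Multiset.prod_cons, norm_mul, pow_succ']
    have ha := hs a (Multiset.mem_cons_self a s)
    have h1 : 3 ≤ ‖z / a‖ := by
      rw [norm_div, le_div_iff₀ (norm_pos_iff.2 ha.1), hz]
      linarith [ha.2]
    have h2 := norm_sub_norm_le (z / a) 1
    rw [norm_one, norm_sub_rev] at h2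
    have := ih fun w hw => hs w (Multiset.mem_cons_of_mem hw)
    gcongr
    linarith

theorem one_le_norm_prod {R : ℝ} {z : ℂ} (hz : 2 * R ≤ ‖z‖) (s : Multiset ℂ)
    (hs : ∀ w ∈ s, w ≠ 0 ∧ ‖w‖ ≤ R) :
    1 ≤ ‖(s.map fun w => 1 - z / w).prod‖ := by
  induction s using Multiset.induction_on with
  | empty => simp
  | cons a s ih =>
    rw [Multiset.map_cons, Multiset.prod_cons, norm_mul]
    have ha := hs a (Multiset.mem_cons_self a s)
    exact one_le_mul_of_one_le_of_one_le (one_le_norm_one_sub_div ha.1 ha.2 hz)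
      (ih fun w hw => hs w (Multiset.mem_cons_of_mem hw))

/-- An upper bound on a circle around the origin holds inside it. -/
theorem norm_le_of_forall_norm_eq {g : ℂ → ℂ} (hg : Differentiable ℂ g) {R C : ℝ} (hR : 0 < R)
    (hC : ∀ z, ‖z‖ = R → ‖g z‖ ≤ C) {z : ℂ} (hz : ‖z‖ ≤ R) : ‖g z‖ ≤ C := by
  refine Complex.norm_le_of_forall_mem_frontier_norm_le (U := ball (0 : ℂ) R) isBounded_ball
    hg.diffContOnCl (fun z hz => hC z ?_) ?_
  · rw [frontier_ball _ hR.ne'] at hz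
    simpa using hz
  · rw [closure_ball _ hR.ne']
    simpa using hz

/-- All the zeros of an entire function in a disc can be split off. -/
theorem exists_factorization_closedBall {f : ℂ → ℂ} (hf : Differentiable ℂ f) (h0 : f 0 ≠ 0)
    {R : ℝ} (hR : 0 < R) :
    ∃ (s : Multiset ℂ) (g : ℂ → ℂ), Differentiable ℂ g ∧
      (∀ w ∈ s, f w = 0 ∧ w ≠ 0 ∧ ‖w‖ ≤ R) ∧
      (∀ z, f z = (s.map fun w => 1 - z / w).prod * g z) ∧ ∀ z, ‖z‖ ≤ R → g z ≠ 0 := by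
  let Q : Multiset ℂ → (ℂ → ℂ) → Prop := fun s g => Differentiable ℂ g ∧
      (∀ w ∈ s, f w = 0 ∧ w ≠ 0 ∧ ‖w‖ ≤ R) ∧
      (∀ z, f z = (s.map fun w => 1 - z / w).prod * g z)
  obtain ⟨C, hC⟩ : ∃ C, ∀ z : ℂ, ‖z‖ = 3 * R → ‖f z‖ ≤ C := by
    obtain ⟨C, hC⟩ := (isCompact_sphere (0 : ℂ) (3 * R)).exists_bound_of_continuousOn
      hf.continuous.continuousOn
    exact ⟨C, fun z hz => hC z (by simpa using hz)⟩
  -- The maximum principle for the cofactor `g` on the circle of radius 3R bounds the number of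
  -- split zeros, so splitting must stop.
  have hbound : ∀ s g, Q s g → (2 : ℝ) ^ s.card * ‖f 0‖ ≤ C := by
    rintro s g ⟨hg, hs, hfac⟩
    have hg0 : g 0 = f 0 := by rw [hfac 0]; simp
    have h2 : (0 : ℝ) < 2 ^ s.card := by positivity
    have := norm_le_of_forall_norm_eq hg (C := C / 2 ^ s.card) (R := 3 * R) (by linarith)
      (fun z hz => by
        rw [le_div_iff₀ h2, mul_comm]
        refine le_trans ?_ (hC z hz)
        rw [hfac z, norm_mul]
        gcongr
        exact two_pow_le_norm_prod hz s fun w hw => (hs w hw).2) (z := 0) (by simpa using hR.le)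
    rw [hg0, le_div_iff₀ h2] at this
    linarith
  obtain ⟨N, hN⟩ : ∃ N : ℕ, C < 2 ^ N * ‖f 0‖ := by
    obtain ⟨N, hN⟩ := pow_unbounded_of_one_lt (C / ‖f 0‖) (one_lt_two)
    exact ⟨N, by rwa [div_lt_iff₀ (norm_pos_iff.2 h0)] at hN⟩
  by_contra! hcon
  have hall : ∀ n : ℕ, ∃ s g, Q s g ∧ s.card = n := by
    intro n
    induction n with
    | zero => exact ⟨0, f, ⟨hf, by simp, by simp⟩, rfl⟩
    | succ n ih =>
      obtain ⟨s, g, hQ, hn⟩ := ih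
      obtain ⟨z, hz, hgz⟩ := hcon s g hQ.1 hQ.2.1 hQ.2.2
      have hfz : f z = 0 := by rw [hQ.2.2, hgz, mul_zero]
      have hz0 : z ≠ 0 := by rintro rfl; exact h0 hfz
      obtain ⟨k, hk, hgk⟩ := exists_differentiable_eq_one_sub_div_mul hQ.1 hz0 hgz
      refine ⟨z ::ₘ s, k, ⟨hk, ?_, fun u => ?_⟩, by simp [hn]⟩
      · intro w hw
        rcases Multiset.mem_cons.1 hw with rfl | hw
        · exact ⟨hfz, hz0, hz⟩
        · exact hQ.2.1 w hw
      · rw [Multiset.map_cons, Multiset.prod_cons, hQ.2.2 u, hgk u]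
        ring
  obtain ⟨s, g, hQ, hn⟩ := hall N
  have := hbound s g hQ
  rw [hn] at this
  linarith

/-- A nonvanishing holomorphic function on a disc has a holomorphic logarithm. -/
theorem exists_log_of_ne_zero_on_ball {g : ℂ → ℂ} (hg : Differentiable ℂ g) {R : ℝ} (hR : 0 < R)
    (h : ∀ z ∈ ball (0 : ℂ) R, g z ≠ 0) :
    ∃ L : ℂ → ℂ, DifferentiableOn ℂ L (ball 0 R) ∧ L 0 = 0 ∧
      ∀ z ∈ ball (0 : ℂ) R, g z = g 0 * exp (L z) := by
  have hd : DifferentiableOn ℂ (fun z => deriv g z / g z) (ball 0 R) :=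
    (hg.differentiableOn.deriv isOpen_ball).div hg.differentiableOn h
  obtain ⟨L, hL0, hL⟩ := (hd.isExactOn_ball).with_val_at 0 0
  refine ⟨L, fun z hz => (hL z hz).differentiableAt.differentiableWithinAt, hL0, fun z hz => ?_⟩
  have h0 : (0 : ℂ) ∈ ball (0 : ℂ) R := mem_ball_self hR
  have key : ∀ u ∈ ball (0 : ℂ) R, HasDerivAt (fun z => g z * exp (-L z)) 0 u := by
    intro u hu
    have := (hg u).hasDerivAt.mul ((hL u hu).neg.cexp)
    refine this.congr_deriv ?_
    field_simp [h u hu]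
    ring
  have hconst := (convex_ball (0 : ℂ) R).is_const_of_fderivWithin_eq_zero (𝕜 := ℂ)
    (f := fun z => g z * exp (-L z))
    (fun u hu => (key u hu).differentiableAt.differentiableWithinAt) (fun u hu => by
      rw [fderivWithin_of_isOpen isOpen_ball hu]
      ext
      simpa using (key u hu).deriv) hz h0
  simp only [hL0, neg_zero, exp_zero, mul_one] at hconst
  rw [← hconst, mul_assoc, ← exp_add]
  simp

/-- The factors at c and -c pair up to 1 - c²/w²; all pairs except those of a and b are at most 1
and are dropped. -/
theorem norm_prod_mul_norm_prod_le {c : ℂ} (s : Multiset ℂ)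
    (hs : ∀ w ∈ s, ‖1 - c ^ 2 / w ^ 2‖ ≤ 1) {a b : ℂ} (ha : a ∈ s) (hb : b ∈ s) (hab : a ≠ b) :
    ‖(s.map fun w => 1 - c / w).prod‖ * ‖(s.map fun w => 1 - -c / w).prod‖ ≤
      ‖1 - c ^ 2 / a ^ 2‖ * ‖1 - c ^ 2 / b ^ 2‖ := by
  have hprod : ∀ t : Multiset ℂ, (∀ w ∈ t, ‖1 - c ^ 2 / w ^ 2‖ ≤ 1) →
      ‖(t.map fun w => 1 - c ^ 2 / w ^ 2).prod‖ ≤ 1 := by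
    intro t
    induction t using Multiset.induction_on with
    | empty => simp
    | cons x t ih =>
      intro ht
      rw [Multiset.map_cons, Multiset.prod_cons, norm_mul]
      exact mul_le_one₀ (ht x (Multiset.mem_cons_self x t)) (norm_nonneg _)
        (ih fun w hw => ht w (Multiset.mem_cons_of_mem hw))
  rw [← norm_mul, ← Multiset.prod_map_mul]
  have : (fun w : ℂ => (1 - c / w) * (1 - -c / w)) = fun w => 1 - c ^ 2 / w ^ 2 := by
    ext w; ring
  rw [this]
  obtain ⟨t, rfl⟩ := Multiset.exists_cons_of_mem ha
  have hb' : b ∈ t := (Multiset.mem_cons.1 hb).resolve_left hab.symm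
  obtain ⟨u, rfl⟩ := Multiset.exists_cons_of_mem hb'
  simp only [Multiset.map_cons, Multiset.prod_cons, norm_mul]
  have := hprod u fun w hw => hs w (by simp [hw])
  rw [← mul_assoc]
  exact mul_le_of_le_one_right (by positivity) this

/-- For an entire function of growth `exp (o ‖z‖)` all of whose zeros `w` satisfy
`‖1 - c ^ 2 / w ^ 2‖ ≤ 1`, two distinct zeros bound the value of `f c * f (-c)`. -/
theorem norm_mul_norm_neg_le_of_zeros {f : ℂ → ℂ} (hf : Differentiable ℂ f) (h0 : f 0 ≠ 0)
    (hgrowth : ∀ ε > 0, ∀ᶠ r : ℝ in atTop, ∀ z, ‖z‖ = r → ‖f z‖ ≤ Real.exp (ε * r))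
    {c : ℂ} (hc : ∀ w, f w = 0 → ‖1 - c ^ 2 / w ^ 2‖ ≤ 1) {a b : ℂ} (ha : f a = 0) (hb : f b = 0)
    (hab : a ≠ b) :
    ‖f c‖ * ‖f (-c)‖ ≤ ‖f 0‖ ^ 2 * (‖1 - c ^ 2 / a ^ 2‖ * ‖1 - c ^ 2 / b ^ 2‖) := by
  have hf0 : 0 < ‖f 0‖ := norm_pos_iff.2 h0
  have main : ∀ ε > 0, ‖f c‖ * ‖f (-c)‖ ≤
      (‖f 0‖ ^ 2 * (‖1 - c ^ 2 / a ^ 2‖ * ‖1 - c ^ 2 / b ^ 2‖)) * Real.exp (ε * (24 * ‖c‖)) := by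
    intro ε hε
    have hdouble : Tendsto (fun r : ℝ => 2 * r) atTop atTop :=
      tendsto_id.const_mul_atTop (by norm_num)
    have hlin : Tendsto (fun r : ℝ => ε * r) atTop atTop := tendsto_id.const_mul_atTop hε
    obtain ⟨R, hgr, hR0, hRc, hRa, hRb, hRf⟩ :=
      ((hdouble.eventually (hgrowth ε hε)).and ((eventually_gt_atTop (0 : ℝ)).and
        ((eventually_gt_atTop (2 * ‖c‖)).and ((eventually_ge_atTop ‖a‖).and
          ((eventually_ge_atTop ‖b‖).and
            (hlin.eventually_ge_atTop (-Real.log ‖f 0‖))))))).exists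
    obtain ⟨s, g, hg, hs, hfac, hgne⟩ := exists_factorization_closedBall hf h0 hR0
    have hg0 : g 0 = f 0 := by rw [hfac 0]; simp
    have hmem : ∀ w, f w = 0 → ‖w‖ ≤ R → w ∈ s := by
      intro w hw hwR
      rw [hfac w, mul_eq_zero, or_iff_left (hgne w hwR), Multiset.prod_eq_zero_iff,
        Multiset.mem_map] at hw
      obtain ⟨u, hu, huw⟩ := hw
      have hu0 := (hs u hu).2.1
      exact (div_eq_one_iff_eq hu0).1 (sub_eq_zero.1 huw).symm ▸ hu
    -- The split factors have modulus at least 1 on the circle of radius 2R, so `g` inherits the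
    -- growth bound of `f` there.
    have hgle : ∀ z : ℂ, ‖z‖ ≤ 2 * R → ‖g z‖ ≤ Real.exp (ε * (2 * R)) := fun z hz =>
      norm_le_of_forall_norm_eq hg (by linarith) (fun u hu => by
        refine le_trans ?_ (hgr u hu)
        rw [hfac u, norm_mul]
        exact le_mul_of_one_le_left (norm_nonneg _)
          (one_le_norm_prod hu.ge s fun w hw => (hs w hw).2)) hz
    obtain ⟨L, hLd, hL0, hL⟩ := exists_log_of_ne_zero_on_ball hg hR0
      (fun z hz => hgne z (by simpa using (mem_ball_zero_iff.1 hz).le))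
    -- Of the 3εR, the growth at radius 2R takes 2εR, and εR absorbs -log ‖f 0‖.
    have hLre : Set.MapsTo L (ball 0 R) {z | z.re ≤ 3 * ε * R} := by
      intro z hz
      have h1 := hgle z (by linarith [mem_ball_zero_iff.1 hz])
      rw [hL z hz, norm_mul, norm_exp, hg0] at h1
      have h2 := Real.log_le_log (by positivity) h1
      rw [Real.log_mul hf0.ne' (Real.exp_pos _).ne', Real.log_exp, Real.log_exp] at h2
      change (L z).re ≤ 3 * ε * R
      linarith
    have hexp : ∀ z : ℂ, ‖z‖ = ‖c‖ → ‖g z‖ ≤ ‖f 0‖ * Real.exp (ε * (12 * ‖c‖)) := by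
      intro z hz
      have hzb : z ∈ ball (0 : ℂ) R := by
        rw [mem_ball_zero_iff, hz]
        linarith [norm_nonneg c]
      -- The bound 2(3εR)‖c‖/(R - ‖c‖) is at most 12ε‖c‖ because R > 2‖c‖. It no longer involves R,
      -- so ε can tend to 0.
      have hB := borelCaratheodory_zero (by positivity) hLd hLre hR0 hzb hL0
      rw [hL z hzb, norm_mul, norm_exp, hg0]
      gcongr
      refine (re_le_norm _).trans (hB.trans ?_)
      rw [hz, div_le_iff₀ (by linarith [norm_nonneg c])]
      have : 0 ≤ ε * ‖c‖ := by positivity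
      nlinarith
    have hP := norm_prod_mul_norm_prod_le s (fun w hw => hc w (hs w hw).1) (hmem a ha hRa)
      (hmem b hb hRb) hab
    have h1 := hexp c rfl
    have h2 := hexp (-c) (norm_neg c)
    have h12 := mul_le_mul h1 h2 (norm_nonneg _) (by positivity)
    rw [hfac c, hfac (-c), norm_mul, norm_mul]
    calc _ = (‖(s.map fun w => 1 - c / w).prod‖ * ‖(s.map fun w => 1 - -c / w).prod‖) *
          (‖g c‖ * ‖g (-c)‖) := by ring
      _ ≤ (‖1 - c ^ 2 / a ^ 2‖ * ‖1 - c ^ 2 / b ^ 2‖) *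
          ((‖f 0‖ * Real.exp (ε * (12 * ‖c‖))) * (‖f 0‖ * Real.exp (ε * (12 * ‖c‖)))) := by
        gcongr
      _ = _ := by
        rw [show ε * (24 * ‖c‖) = ε * (12 * ‖c‖) + ε * (12 * ‖c‖) by ring, Real.exp_add]
        ring
  have hlim : Tendsto (fun ε : ℝ =>
      (‖f 0‖ ^ 2 * (‖1 - c ^ 2 / a ^ 2‖ * ‖1 - c ^ 2 / b ^ 2‖)) * Real.exp (ε * (24 * ‖c‖)))
      (𝓝[>] 0) (𝓝 ((‖f 0‖ ^ 2 * (‖1 - c ^ 2 / a ^ 2‖ * ‖1 - c ^ 2 / b ^ 2‖)) *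
        Real.exp (0 * (24 * ‖c‖)))) := by
    refine Tendsto.mono_left ?_ nhdsWithin_le_nhds
    exact Continuous.tendsto (by fun_prop) 0
  rw [zero_mul, Real.exp_zero, mul_one] at hlim
  exact ge_of_tendsto hlim (eventually_nhdsWithin_of_forall fun ε hε => main ε hε)

/-! ### The theta tail and its partial Mellin transform -/

open MeasureTheory Set in
theorem integrableOn_rpow_mul_exp_neg (p : ℝ) {c : ℝ} (hc : 0 < c) :
    IntegrableOn (fun x : ℝ => x ^ p * Real.exp (-c * x)) (Ioi 1) := by
  refine integrable_of_isBigO_exp_neg (b := c / 2) (by positivity) ?_ ?_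
  · refine ContinuousOn.mul ?_ (by fun_prop)
    exact ContinuousOn.rpow_const continuousOn_id fun x hx =>
      Or.inl (zero_lt_one.trans_le hx).ne'
  · have h := (isLittleO_rpow_exp_pos_mul_atTop p (b := c / 2) (by positivity)).isBigO
    refine (h.mul (Asymptotics.isBigO_refl (fun x => Real.exp (-c * x)) atTop)).congr_right ?_
    intro x
    rw [← Real.exp_add]
    ring_nf

/-- The function `ψ x = ∑_{n ≥ 1} exp (-π n² x)`. -/
noncomputable def thetaTail (x : ℝ) : ℝ := (HurwitzZeta.evenKernel 0 x - 1) / 2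

theorem hasSum_thetaTail {x : ℝ} (hx : 0 < x) :
    HasSum (fun n : ℕ => Real.exp (-Real.pi * (n + 1) ^ 2 * x)) (thetaTail x) := by
  have h := (HurwitzZeta.hasSum_nat_cosKernel₀ 0 hx).div_const 2
  have h0 : HurwitzZeta.cosKernel ((0 : ℝ) : UnitAddCircle) x = HurwitzZeta.evenKernel 0 x := by
    rw [HurwitzZeta.evenKernel_eq_cosKernel_of_zero]; rfl
  rw [h0] at h
  refine h.congr_fun fun n => ?_
  simp

theorem exp_le_thetaTail {x : ℝ} (hx : 0 < x) : Real.exp (-Real.pi * x) ≤ thetaTail x := by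
  have := le_hasSum (hasSum_thetaTail hx) 0 fun n _ => (Real.exp_pos _).le
  simpa using this

/-- After the first term, (n + 2)²πx ≥ 4πx + n, so the rest is dominated by a geometric series of
ratio 1/2 and sum 2. -/
theorem thetaTail_le {x : ℝ} (hx : 1 ≤ x) :
    thetaTail x ≤ Real.exp (-Real.pi * x) + 2 * Real.exp (-4 * Real.pi * x) := by
  have hx0 : 0 < x := by linarith
  have h := hasSum_thetaTail hx0
  rw [← hasSum_nat_add_iff' 1] at h
  simp only [Finset.sum_range_one, Nat.cast_zero, zero_add, one_pow, mul_one] at h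
  have hπ := Real.pi_gt_three
  have hg : HasSum (fun n : ℕ => Real.exp (-4 * Real.pi * x) * (1 / 2 : ℝ) ^ n)
      (Real.exp (-4 * Real.pi * x) * 2) := hasSum_geometric_two.mul_left _
  have hhalf : Real.exp (-1) ≤ 1 / 2 := by
    have := Real.exp_one_gt_d9
    rw [Real.exp_neg, inv_le_comm₀ (Real.exp_pos _) (by norm_num)]
    linarith
  have hle := hasSum_le (fun n : ℕ => ?_) h hg
  · linarith
  · calc Real.exp (-Real.pi * (((n + 1 : ℕ) : ℝ) + 1) ^ 2 * x)
        ≤ Real.exp (-4 * Real.pi * x + n * (-1)) := by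
          apply Real.exp_le_exp.2
          push_cast
          have hn : (0 : ℝ) ≤ n := n.cast_nonneg
          have h1 : 1 ≤ Real.pi * x := by nlinarith
          have h2 : 0 ≤ (n : ℝ) * (Real.pi * x - 1) := mul_nonneg hn (by linarith)
          have h3 : 0 ≤ (n ^ 2 + 3 * n : ℝ) * (Real.pi * x) := by positivity
          nlinarith
      _ ≤ Real.exp (-4 * Real.pi * x) * (1 / 2 : ℝ) ^ n := by
          rw [Real.exp_add, Real.exp_nat_mul]
          gcongr

theorem thetaTail_nonneg {x : ℝ} (hx : 0 < x) : 0 ≤ thetaTail x :=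
  (Real.exp_pos _).le.trans (exp_le_thetaTail hx)

theorem exp_neg_three_pi_le : Real.exp (-3 * Real.pi) ≤ 1 / 5000 := by
  have h1 : Real.exp (-3 * Real.pi) ≤ Real.exp (-9) :=
    Real.exp_le_exp.2 (by linarith [Real.pi_gt_three])
  refine h1.trans ?_
  have h2 : Real.exp (-9) = (Real.exp 1 ^ 9)⁻¹ := by
    rw [← Real.exp_nat_mul, ← Real.exp_neg]; norm_num
  rw [h2, inv_le_comm₀ (by positivity) (by norm_num)]
  calc ((1 : ℝ) / 5000)⁻¹ ≤ 2.7 ^ 9 := by norm_num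
    _ ≤ Real.exp 1 ^ 9 := by
      gcongr
      linarith [Real.exp_one_gt_d9]

theorem thetaTail_le_mul_exp {x : ℝ} (hx : 1 ≤ x) :
    thetaTail x ≤ 1.0004 * Real.exp (-Real.pi * x) := by
  have h1 := thetaTail_le hx
  have h2 : Real.exp (-4 * Real.pi * x) ≤ 1 / 5000 * Real.exp (-Real.pi * x) := by
    refine le_trans ?_ (mul_le_mul_of_nonneg_right exp_neg_three_pi_le (Real.exp_pos _).le)
    rw [← Real.exp_add]
    apply Real.exp_le_exp.2
    nlinarith [Real.pi_pos]
  linarith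

open Set in
theorem continuousOn_thetaTail : ContinuousOn thetaTail (Ioi 0) :=
  ((HurwitzZeta.continuousOn_evenKernel 0).sub continuousOn_const).div_const 2

open Set in
theorem continuousOn_ofReal_cpow_Ioi (s : ℂ) : ContinuousOn (fun x : ℝ => (x : ℂ) ^ s) (Ioi 0) :=
  fun x hx => (continuousAt_ofReal_cpow_const x s (Or.inr (ne_of_gt hx))).continuousWithinAt

open MeasureTheory Set in
theorem integrableOn_rpow_mul_thetaTail (p : ℝ) :
    IntegrableOn (fun x : ℝ => x ^ p * thetaTail x) (Ioi 1) := by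
  refine Integrable.mono' ((integrableOn_rpow_mul_exp_neg p Real.pi_pos).const_mul 1.0004) ?_ ?_
  · refine ContinuousOn.aestronglyMeasurable ?_ measurableSet_Ioi
    refine ContinuousOn.mul (ContinuousOn.rpow_const continuousOn_id fun x hx =>
      Or.inl (zero_lt_one.trans hx).ne') ?_
    exact continuousOn_thetaTail.mono (Ioi_subset_Ioi zero_le_one)
  · filter_upwards [ae_restrict_mem measurableSet_Ioi] with x hx
    have hx0 : (0 : ℝ) < x := zero_lt_one.trans hx
    rw [Real.norm_of_nonneg (mul_nonneg (by positivity) (thetaTail_nonneg hx0))]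
    calc x ^ p * thetaTail x ≤ x ^ p * (1.0004 * Real.exp (-Real.pi * x)) := by
          gcongr
          exact thetaTail_le_mul_exp (le_of_lt hx)
      _ = _ := by ring

open MeasureTheory Set in
theorem integrableOn_cpow_mul_thetaTail (s : ℂ) :
    IntegrableOn (fun x : ℝ => (x : ℂ) ^ s * (thetaTail x : ℂ)) (Ioi 1) := by
  refine Integrable.mono' (integrableOn_rpow_mul_thetaTail s.re) ?_ ?_
  · refine ContinuousOn.aestronglyMeasurable ?_ measurableSet_Ioi
    refine ContinuousOn.mono (ContinuousOn.mul (continuousOn_ofReal_cpow_Ioi s) ?_)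
      (Ioi_subset_Ioi zero_le_one)
    exact continuous_ofReal.comp_continuousOn continuousOn_thetaTail
  · filter_upwards [ae_restrict_mem measurableSet_Ioi] with x hx
    have hx0 : (0 : ℝ) < x := zero_lt_one.trans hx
    rw [norm_mul, norm_cpow_eq_rpow_re_of_pos hx0, norm_real,
      Real.norm_of_nonneg (thetaTail_nonneg hx0)]

open MeasureTheory Set in
/-- The partial Mellin transform `∫_1^∞ x ^ (s - 1) ψ x dx`. -/
noncomputable def thetaMellin (s : ℂ) : ℂ := ∫ x in Ioi (1 : ℝ), (x : ℂ) ^ (s - 1) * (thetaTail x : ℂ)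

-- Riemann's splitting at x = 1. `f_modif`, whose Mellin transform is Λ₀, equals A = 2ψ on (1, ∞).
-- The theta functional equation turns its part on (0, 1) into x^(-1/2) A(1/x), and inversion
-- exchanges s/2 with 1/2 - s/2.
open MeasureTheory Set in
theorem completedRiemannZeta₀_eq_thetaMellin (s : ℂ) :
    completedRiemannZeta₀ s = thetaMellin (s / 2) + thetaMellin ((1 - s) / 2) := by
  set A : ℝ → ℂ := (Ioi 1).indicator fun x => 2 * (thetaTail x : ℂ) with hA
  have hmel : ∀ w : ℂ, HasMellin A w (2 * thetaMellin w) := by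
    intro w
    have e : (fun t : ℝ => (t : ℂ) ^ (w - 1) • A t) =
        (Ioi 1).indicator fun x : ℝ => 2 * ((x : ℂ) ^ (w - 1) * (thetaTail x : ℂ)) := by
      ext t
      by_cases ht : t ∈ Ioi (1 : ℝ)
      · simp only [hA, indicator_of_mem ht, smul_eq_mul]; ring
      · simp only [hA, indicator_of_notMem ht, smul_zero]
    have hsub : Ioi (1 : ℝ) ⊆ Ioi 0 := Ioi_subset_Ioi zero_le_one
    constructor
    · rw [MellinConvergent, e]
      exact ((integrable_indicator_iff measurableSet_Ioi).2
        ((integrableOn_cpow_mul_thetaTail (w - 1)).const_mul 2)).integrableOn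
    · rw [mellin, e, setIntegral_indicator measurableSet_Ioi, inter_eq_right.2 hsub,
        integral_const_mul]
      rfl
  set P := HurwitzZeta.hurwitzEvenFEPair 0 with hP
  have hB : P.f_modif = A + fun x => A x⁻¹ * (x : ℂ) ^ (-(1 / 2) : ℂ) := by
    have hA1 : ∀ x, 1 < x → A x = 2 * (thetaTail x : ℂ) := fun x hx => indicator_of_mem hx _
    have hA0 : ∀ x, x ≤ 1 → A x = 0 := fun x hx => indicator_of_notMem (notMem_Ioi.2 hx) _
    have h1 : ∀ x, 1 < x → P.f_modif x = A x := by
      intro x hx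
      rw [hA1 x hx, WeakFEPair.f_modif, Pi.add_apply, indicator_of_mem (mem_Ioi.2 hx),
        indicator_of_notMem (notMem_Ioo_of_ge hx.le)]
      simp only [hP, HurwitzZeta.hurwitzEvenFEPair, Function.comp_apply, if_true, thetaTail]
      push_cast
      ring
    have h2 : ∀ x, 1 < x → P.g_modif x = A x := by
      intro x hx
      rw [hA1 x hx, WeakFEPair.g_modif, Pi.add_apply, indicator_of_mem (mem_Ioi.2 hx),
        indicator_of_notMem (notMem_Ioo_of_ge hx.le)]
      simp only [hP, HurwitzZeta.hurwitzEvenFEPair, Function.comp_apply, thetaTail,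
        HurwitzZeta.evenKernel_eq_cosKernel_of_zero]
      push_cast
      ring
    ext x
    rw [Pi.add_apply]
    rcases lt_trichotomy 1 x with hx | rfl | hx
    · rw [h1 x hx, hA0 x⁻¹ (inv_le_one_of_one_le₀ hx.le), zero_mul, add_zero]
    · rw [inv_one, hA0 1 le_rfl, WeakFEPair.f_modif]
      simp
    · rw [hA0 x hx.le, zero_add]
      rcases le_or_gt x 0 with hx0 | hx0
      · rw [hA0 x⁻¹ ((inv_nonpos.2 hx0).trans zero_le_one), zero_mul, WeakFEPair.f_modif,
          Pi.add_apply, indicator_of_notMem (notMem_Ioi.2 hx.le),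
          indicator_of_notMem (notMem_Ioo_of_le hx0), add_zero]
      · have hx1 : 1 < x⁻¹ := (one_lt_inv₀ hx0).2 hx
        have hFE := P.hf_modif_FE x⁻¹ (by positivity)
        rw [h2 _ hx1, one_div, inv_inv] at hFE
        rw [hFE]
        simp only [hP, HurwitzZeta.hurwitzEvenFEPair, one_mul, smul_eq_mul]
        rw [mul_comm, Real.inv_rpow hx0.le, ← Real.rpow_neg hx0.le, ofReal_cpow hx0.le]
        push_cast
        rfl
  have hinv : ∀ w : ℂ, HasMellin (fun x : ℝ => A x⁻¹ * (x : ℂ) ^ (-(1 / 2) : ℂ)) w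
      (2 * thetaMellin (1 / 2 - w)) := by
    intro w
    have h1 := hmel (1 / 2 - w)
    constructor
    · have h2 : MellinConvergent (fun x : ℝ => A x⁻¹) (w - 1 / 2) := by
        have := (MellinConvergent.comp_rpow (f := A) (s := w - 1 / 2) (a := -1) (by norm_num)).2
          (by convert h1.1 using 1; push_cast; ring)
        simpa [Real.rpow_neg_one] using this
      have := (MellinConvergent.cpow_smul (f := fun x : ℝ => A x⁻¹) (s := w)
        (a := -(1 / 2))).2 (by simpa [sub_eq_add_neg] using h2)
      simpa [mul_comm] using this
    · have h3 := mellin_cpow_smul (fun x : ℝ => A x⁻¹) w (-(1 / 2))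
      rw [mellin_comp_inv] at h3
      have h4 := h1.2
      rw [show (1 / 2 - w : ℂ) = -(w + -(1 / 2)) by ring] at h4 ⊢
      rw [← h4, ← h3]
      simp [mul_comm]
  have hsum := hasMellin_add (hmel (s / 2)).1 (hinv (s / 2)).1
  have : P.Λ₀ (s / 2) = 2 * thetaMellin (s / 2) + 2 * thetaMellin (1 / 2 - s / 2) := by
    rw [WeakFEPair.Λ₀, hB, ← (hmel (s / 2)).2, ← (hinv (s / 2)).2]
    exact hsum.2
  rw [completedRiemannZeta₀, HurwitzZeta.completedHurwitzZetaEven₀, ← hP, this,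
    show (1 - s) / 2 = 1 / 2 - s / 2 by ring]
  ring

open MeasureTheory Set in
theorem norm_thetaMellin_le (s : ℂ) :
    ‖thetaMellin s‖ ≤ ∫ x in Ioi (1 : ℝ), x ^ (s.re - 1) * thetaTail x := by
  refine (norm_integral_le_integral_norm _).trans (le_of_eq ?_)
  refine setIntegral_congr_fun measurableSet_Ioi fun x hx => ?_
  have hx0 : (0 : ℝ) < x := zero_lt_one.trans hx
  simp only [norm_mul, norm_cpow_eq_rpow_re_of_pos hx0, norm_real,
    Real.norm_of_nonneg (thetaTail_nonneg hx0), sub_re, one_re]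

open MeasureTheory Set in
theorem thetaMellin_ofReal (r : ℝ) :
    thetaMellin r = ((∫ x in Ioi (1 : ℝ), x ^ (r - 1) * thetaTail x : ℝ) : ℂ) := by
  rw [thetaMellin]
  refine Eq.trans ?_ integral_ofReal
  refine setIntegral_congr_fun measurableSet_Ioi fun x hx => ?_
  have hx0 : (0 : ℝ) < x := zero_lt_one.trans hx
  change _ = ((x ^ (r - 1) * thetaTail x : ℝ) : ℂ)
  rw [ofReal_mul, ofReal_cpow hx0.le]
  push_cast
  rfl

open MeasureTheory Set ComplexConjugate in
theorem thetaMellin_conj (s : ℂ) : thetaMellin (conj s) = conj (thetaMellin s) := by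
  rw [thetaMellin, thetaMellin, ← integral_conj]
  refine setIntegral_congr_fun measurableSet_Ioi fun x hx => ?_
  have hx0 : (0 : ℝ) < x := zero_lt_one.trans hx
  have harg : ((x : ℝ) : ℂ).arg ≠ Real.pi := by
    rw [arg_ofReal_of_nonneg hx0.le]
    exact Real.pi_pos.ne
  change (x : ℂ) ^ (conj s - 1) * (thetaTail x : ℂ) = conj ((x : ℂ) ^ (s - 1) * (thetaTail x : ℂ))
  rw [map_mul, conj_ofReal, show conj s - 1 = conj (s - 1) by simp, cpow_conj _ _ harg, conj_ofReal]

open ComplexConjugate in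
theorem completedRiemannZeta₀_conj (s : ℂ) :
    completedRiemannZeta₀ (conj s) = conj (completedRiemannZeta₀ s) := by
  rw [completedRiemannZeta₀_eq_thetaMellin, completedRiemannZeta₀_eq_thetaMellin, map_add,
    ← thetaMellin_conj, ← thetaMellin_conj]
  simp [map_ofNat]

/-! ### Bounds for Λ₀ in the critical strip and growth of the Mellin transform -/

open MeasureTheory Set in
theorem hasIntegral_quadratic_mul_exp_neg (α β γ : ℝ) {c : ℝ} (hc : 0 < c) :
    IntegrableOn (fun x : ℝ => (α + β * (x - 1) + γ * (x - 1) ^ 2) * Real.exp (-c * x)) (Ioi 1) ∧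
    ∫ x in Ioi (1 : ℝ), (α + β * (x - 1) + γ * (x - 1) ^ 2) * Real.exp (-c * x) =
      Real.exp (-c) * (α / c + β / c ^ 2 + 2 * γ / c ^ 3) := by
  have hint : IntegrableOn
      (fun x : ℝ => (α + β * (x - 1) + γ * (x - 1) ^ 2) * Real.exp (-c * x)) (Ioi 1) := by
    have h0 := integrableOn_rpow_mul_exp_neg 0 hc
    have h1 := integrableOn_rpow_mul_exp_neg 1 hc
    have h2 := integrableOn_rpow_mul_exp_neg 2 hc
    refine (((h0.const_mul (α - β + γ)).add (h1.const_mul (β - 2 * γ))).add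
      (h2.const_mul γ)).congr ?_
    filter_upwards with x
    simp only [Pi.add_apply, Real.rpow_zero, Real.rpow_one, Real.rpow_two]
    ring
  refine ⟨hint, ?_⟩
  set g : ℝ → ℝ := fun x => -Real.exp (-c * x) * ((α + β * (x - 1) + γ * (x - 1) ^ 2) / c +
    (β + 2 * γ * (x - 1)) / c ^ 2 + 2 * γ / c ^ 3) with hg
  have hderiv : ∀ x, HasDerivAt g
      ((α + β * (x - 1) + γ * (x - 1) ^ 2) * Real.exp (-c * x)) x := by
    intro x
    have e : HasDerivAt (fun x : ℝ => -Real.exp (-c * x)) (-(Real.exp (-c * x) * (-c))) x := by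
      have h := ((hasDerivAt_id x).const_mul (-c)).exp.fun_neg
      simpa using h
    have u : HasDerivAt (fun x : ℝ => x - 1) 1 x := (hasDerivAt_id x).sub_const 1
    have p : HasDerivAt (fun x : ℝ => (α + β * (x - 1) + γ * (x - 1) ^ 2) / c +
        (β + 2 * γ * (x - 1)) / c ^ 2 + 2 * γ / c ^ 3)
        ((β * 1 + γ * (2 * (x - 1))) / c + (2 * γ * 1) / c ^ 2) x := by
      have q := (((u.const_mul β).const_add α).add ((u.pow 2).const_mul γ)).div_const c
      have r := ((u.const_mul (2 * γ)).const_add β).div_const (c ^ 2)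
      have := (q.add r).add_const (2 * γ / c ^ 3)
      simpa using this
    refine (e.mul p).congr_deriv ?_
    field_simp
    ring
  have hlim : Tendsto g atTop (𝓝 0) := by
    have h : ∀ n : ℕ, Tendsto (fun x : ℝ => x ^ n * Real.exp (-c * x)) atTop (𝓝 0) := fun n => by
      have := Real.tendsto_pow_mul_exp_neg_atTop_nhds_zero n
      have h1 := (this.comp (tendsto_id.const_mul_atTop hc)).const_mul ((c ^ n)⁻¹)
      rw [mul_zero] at h1
      refine h1.congr fun x => ?_
      simp only [Function.comp_apply, id_eq, mul_pow]
      field_simp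
    have h0 := (h 0).const_mul (-((α - β + γ) / c + (β - 2 * γ) / c ^ 2 + 2 * γ / c ^ 3))
    have h1 := (h 1).const_mul (-((β - 2 * γ) / c + 2 * γ / c ^ 2))
    have h2 := (h 2).const_mul (-(γ / c))
    have := (h0.add h1).add h2
    simp only [mul_zero, add_zero] at this
    refine this.congr fun x => ?_
    simp only [hg]
    ring
  rw [integral_Ioi_of_hasDerivAt_of_tendsto (hderiv 1).continuousAt.continuousWithinAt
    (fun x _ => hderiv x) hint hlim]
  simp only [hg]
  ring_nf

theorem exp_neg_pi_le : Real.exp (-Real.pi) ≤ 0.04323 := by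
  have h1 : Real.exp (-Real.pi) ≤ Real.exp (-(3.1415 : ℝ)) :=
    Real.exp_le_exp.2 (by linarith [Real.pi_gt_d4])
  have h3 : Real.exp (-(0.1415 : ℝ)) ≤ 0.8681 := by
    have h := (abs_le.1 (Real.exp_bound (x := -0.1415) (by rw [abs_le]; norm_num) (n := 5)
      (by norm_num))).2
    rw [abs_neg, abs_of_nonneg (by norm_num)] at h
    norm_num [Finset.sum_range_succ, Nat.factorial] at h ⊢
    linarith
  have h2 : Real.exp (-(3.1415 : ℝ)) = (Real.exp 1 ^ 3)⁻¹ * Real.exp (-(0.1415 : ℝ)) := by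
    rw [← Real.exp_nat_mul, ← Real.exp_neg, ← Real.exp_add]; norm_num
  have h4 : (Real.exp 1 ^ 3)⁻¹ ≤ 0.049788 := by
    rw [inv_le_comm₀ (by positivity) (by norm_num)]
    calc ((0.049788 : ℝ))⁻¹ ≤ 2.71828 ^ 3 := by norm_num
      _ ≤ Real.exp 1 ^ 3 := by
        gcongr
        linarith [Real.exp_one_gt_d9]
  rw [h2] at h1
  calc _ ≤ _ := h1
    _ ≤ 0.049788 * 0.8681 := by gcongr
    _ ≤ _ := by norm_num

open MeasureTheory Set in
/-- A bound for the entire part of the completed zeta function in the critical strip. -/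
theorem norm_completedRiemannZeta₀_le {s : ℂ} (h0 : 0 ≤ s.re) (h1 : s.re ≤ 1) :
    ‖completedRiemannZeta₀ s‖ ≤ 0.02367 := by
  rw [completedRiemannZeta₀_eq_thetaMellin]
  refine (norm_add_le_of_le (norm_thetaMellin_le _) (norm_thetaMellin_le _)).trans ?_
  rw [← integral_add (integrableOn_rpow_mul_thetaTail _) (integrableOn_rpow_mul_thetaTail _)]
  -- The quadratic majorises (3 + x)/(2x) on (1, ∞): the difference times 2x is (3/4)(x - 1)(x -
  -- 2)².
  have hI := hasIntegral_quadratic_mul_exp_neg 2 (-(9 / 8)) (3 / 8) Real.pi_pos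
  have hle := setIntegral_mono_on ((integrableOn_rpow_mul_thetaTail ((s / 2).re - 1)).add
    (integrableOn_rpow_mul_thetaTail (((1 - s) / 2).re - 1))) (hI.1.const_mul 1.0004)
    measurableSet_Ioi fun x hx => ?_
  · refine hle.trans ?_
    rw [integral_const_mul, hI.2]
    have hπ := Real.pi_gt_d4
    have hb : 2 / Real.pi + -(9 / 8) / Real.pi ^ 2 + 2 * (3 / 8) / Real.pi ^ 3 ≤ 0.5472 := by
      set y := Real.pi⁻¹ with hy
      have hy1 : y ≤ 0.31832 := by
        rw [hy, inv_le_comm₀ Real.pi_pos (by norm_num)]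
        exact le_trans (by norm_num) hπ.le
      have hy0 : 0 < y := by positivity
      have : 2 / Real.pi + -(9 / 8) / Real.pi ^ 2 + 2 * (3 / 8) / Real.pi ^ 3 =
          2 * y - 9 / 8 * y ^ 2 + 3 / 4 * y ^ 3 := by
        rw [hy]; field_simp; ring
      rw [this]
      have h5 : 0 ≤ (0.31832 - y) * (2 - 9 / 8 * (y + 0.31832)) :=
        mul_nonneg (by linarith) (by linarith)
      have h6 : y ^ 3 ≤ 0.31832 ^ 3 := by gcongr
      norm_num at h5 h6 ⊢
      nlinarith
    calc _ ≤ 1.0004 * (0.04323 * 0.5472 : ℝ) := by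
          have := mul_le_mul exp_neg_pi_le hb (by
            have : -(9 / 8) / Real.pi ^ 2 ≥ - (2 / Real.pi) := by
              rw [ge_iff_le, neg_div, neg_le_neg_iff, div_le_div_iff₀ (by positivity)
                (by positivity)]
              nlinarith
            have h7 : 0 ≤ 2 * (3 / 8) / Real.pi ^ 3 := by positivity
            linarith) (by norm_num)
          gcongr
      _ ≤ _ := by norm_num
  · have hx1 : (1 : ℝ) < x := hx
    have hx0 : (0 : ℝ) < x := zero_lt_one.trans hx
    simp only [Pi.add_apply]
    have hr1 : (s / 2).re = s.re / 2 := by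
      rw [show s / 2 = s * ((1 / 2 : ℝ) : ℂ) by push_cast; ring, re_mul_ofReal]; ring
    have hr2 : ((1 - s) / 2).re = 1 / 2 - s.re / 2 := by
      rw [show (1 - s) / 2 = (1 - s) * ((1 / 2 : ℝ) : ℂ) by push_cast; ring, re_mul_ofReal]
      simp only [sub_re, one_re]; ring
    rw [hr1, hr2, ← add_mul]
    set r := s.re / 2
    have e1 : x ^ (r - 1) = x ^ r * x⁻¹ := by
      rw [Real.rpow_sub_one hx0.ne', div_eq_mul_inv]
    have e2 : x ^ (1 / 2 - r - 1) = √x * (x ^ r)⁻¹ * x⁻¹ := by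
      rw [Real.rpow_sub_one hx0.ne', Real.rpow_sub hx0, ← Real.sqrt_eq_rpow, div_eq_mul_inv,
        div_eq_mul_inv]
    have hA1 : 1 ≤ x ^ r := Real.one_le_rpow hx1.le (by simp only [r]; linarith)
    have hA2 : x ^ r ≤ √x := by
      rw [Real.sqrt_eq_rpow]
      exact Real.rpow_le_rpow_of_exponent_le hx1.le (by simp only [r]; linarith)
    set B := x ^ r
    have hsq : √x ≤ (1 + x) / 2 := by
      rw [Real.sqrt_le_left (by linarith)]
      nlinarith [sq_nonneg (x - 1)]
    have hB0 : 0 < B := by linarith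
    -- Equivalent to (B - 1)(√x - B) ≥ 0.
    have h3 : B + √x * B⁻¹ ≤ 1 + √x := by
      have : B * (B + √x * B⁻¹) ≤ B * (1 + √x) := by
        have : B * (√x * B⁻¹) = √x := by field_simp
        nlinarith [mul_nonneg (sub_nonneg.2 hA1) (sub_nonneg.2 hA2)]
      exact le_of_mul_le_mul_left this hB0
    have h4 : x ^ (r - 1) + x ^ (1 / 2 - r - 1) ≤
        2 + -(9 / 8) * (x - 1) + 3 / 8 * (x - 1) ^ 2 := by
      rw [e1, e2, ← add_mul, ← div_eq_mul_inv, div_le_iff₀ hx0]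
      nlinarith [mul_nonneg (sub_nonneg.2 hx1.le) (sq_nonneg (x - 2))]
    calc (x ^ (r - 1) + x ^ (1 / 2 - r - 1)) * thetaTail x
        ≤ (2 + -(9 / 8) * (x - 1) + 3 / 8 * (x - 1) ^ 2) *
          (1.0004 * Real.exp (-Real.pi * x)) := by
          have := thetaTail_le_mul_exp hx1.le
          have hp : 0 ≤ x ^ (r - 1) + x ^ (1 / 2 - r - 1) := by positivity
          exact mul_le_mul h4 this (thetaTail_nonneg hx0) (hp.trans h4)
      _ = _ := by ring

-- From log(x/p) ≤ x/p - 1 one gets x^p ≤ p^p e^x, and the decay of ψ absorbs e^x.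
open MeasureTheory Set in
theorem norm_thetaMellin_le_rpow_self {s : ℂ} {p : ℝ} (hp1 : 1 ≤ p) (hp : ‖s‖ ≤ p) :
    ‖thetaMellin s‖ ≤ p ^ p := by
  have hp0 : 0 < p := by linarith
  refine (norm_thetaMellin_le s).trans ?_
  have hI := hasIntegral_quadratic_mul_exp_neg 1 0 0 (c := 2) (by norm_num)
  have hle := setIntegral_mono_on (integrableOn_rpow_mul_thetaTail (s.re - 1))
    (hI.1.const_mul (1.0004 * p ^ p)) measurableSet_Ioi fun x hx => ?_
  · refine hle.trans ?_
    rw [integral_const_mul, hI.2]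
    have he : Real.exp (-2) ≤ 1 := Real.exp_le_one_iff.2 (by norm_num)
    have : 0 ≤ p ^ p := by positivity
    nlinarith [Real.exp_pos (-2)]
  · have hx1 : (1 : ℝ) < x := hx
    have hx0 : (0 : ℝ) < x := zero_lt_one.trans hx
    have h1 : x ^ (s.re - 1) ≤ p ^ p * Real.exp x := by
      calc x ^ (s.re - 1) ≤ x ^ p :=
            Real.rpow_le_rpow_of_exponent_le hx1.le (by linarith [re_le_norm s])
        _ ≤ p ^ p * Real.exp x := by
          rw [Real.rpow_def_of_pos hx0, Real.rpow_def_of_pos hp0, ← Real.exp_add]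
          apply Real.exp_le_exp.2
          have h2 := Real.log_le_sub_one_of_pos (div_pos hx0 hp0)
          rw [Real.log_div hx0.ne' hp0.ne'] at h2
          have h3 : p * (Real.log x - Real.log p) ≤ p * (x / p - 1) := by gcongr
          have h4 : p * (x / p - 1) = x - p := by field_simp
          nlinarith
    calc x ^ (s.re - 1) * thetaTail x
        ≤ (p ^ p * Real.exp x) * (1.0004 * Real.exp (-Real.pi * x)) :=
          mul_le_mul h1 (thetaTail_le_mul_exp hx1.le) (thetaTail_nonneg hx0) (by positivity)
      _ = 1.0004 * p ^ p * (Real.exp (x + -Real.pi * x)) := by rw [Real.exp_add]; ring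
      _ ≤ 1.0004 * p ^ p * (Real.exp (-2 * x)) := by
          gcongr
          nlinarith [Real.pi_gt_three]
      _ = _ := by ring

/-! ### Numerical evaluation of the Mellin transform on the critical line -/

theorem exp_neg_four_pi_le : Real.exp (-4 * Real.pi) ≤ 3.493e-6 := by
  have : Real.exp (-4 * Real.pi) = Real.exp (-Real.pi) ^ 4 := by
    rw [← Real.exp_nat_mul]; congr 1; push_cast; ring
  rw [this]
  calc Real.exp (-Real.pi) ^ 4 ≤ 0.04323 ^ 4 := by
        gcongr
        exact exp_neg_pi_le
    _ ≤ _ := by norm_num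

/-- The Taylor polynomial of degree `47` of `exp (-(355 / 113) * x)`. -/
noncomputable def expTaylor (x : ℝ) : ℝ :=
  ∑ k ∈ Finset.range 48, (-(355 / 113 : ℝ)) ^ k / k.factorial * x ^ k

/-- Replacing π by 355/113 makes the coefficients rational. It costs 2.7e-7 · e^(-2), since x
e^(-πx) ≤ e^(-2); the Taylor remainder costs 1.2e-8. -/
theorem abs_exp_sub_expTaylor_le {x : ℝ} (h1 : 1 ≤ x) (h4 : x ≤ 4) :
    |Real.exp (-Real.pi * x) - expTaylor x| ≤ 5e-8 := by
  have hπ1 := Real.pi_gt_d20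
  have hπ2 := Real.pi_lt_d20
  set q : ℝ := 355 / 113 with hq
  have hqπ : Real.pi ≤ q := by rw [hq]; linarith
  have hqπ2 : q - Real.pi ≤ 2.7e-7 := by rw [hq]; linarith
  have e2 : Real.exp (-2) ≤ 0.14 := by
    have h2 : Real.exp (-2) = (Real.exp 1 ^ 2)⁻¹ := by
      rw [← Real.exp_nat_mul, ← Real.exp_neg]; norm_num
    rw [h2, inv_le_comm₀ (by positivity) (by norm_num)]
    calc ((0.14 : ℝ))⁻¹ ≤ 2.7 ^ 2 := by norm_num
      _ ≤ Real.exp 1 ^ 2 := by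
        gcongr
        linarith [Real.exp_one_gt_d9]
  have hA : |Real.exp (-Real.pi * x) - Real.exp (-q * x)| ≤ 2.7e-7 * 0.14 := by
    have hle : Real.exp (-q * x) ≤ Real.exp (-Real.pi * x) := Real.exp_le_exp.2 (by nlinarith)
    rw [abs_of_nonneg (by linarith)]
    have h2 : Real.exp (-q * x) = Real.exp (-Real.pi * x) * Real.exp (-((q - Real.pi) * x)) := by
      rw [← Real.exp_add]; congr 1; ring
    have h3 := Real.add_one_le_exp (-((q - Real.pi) * x))
    have h4 : Real.exp (-Real.pi * x) - Real.exp (-q * x) ≤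
        Real.exp (-Real.pi * x) * ((q - Real.pi) * x) := by
      rw [h2]
      nlinarith [Real.exp_pos (-Real.pi * x)]
    have h5 : Real.exp (-Real.pi * x) * x ≤ Real.exp (-2) := by
      calc Real.exp (-Real.pi * x) * x ≤ Real.exp (-Real.pi * x) * Real.exp x := by
            gcongr
            linarith [Real.add_one_le_exp x]
        _ ≤ Real.exp (-2) := by
            rw [← Real.exp_add]
            exact Real.exp_le_exp.2 (by nlinarith [Real.pi_gt_three])
    calc _ ≤ _ := h4
      _ = (q - Real.pi) * (Real.exp (-Real.pi * x) * x) := by ring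
      _ ≤ _ := mul_le_mul hqπ2 (h5.trans e2) (by positivity) (by norm_num)
  have hB : |Real.exp (-q * x) - expTaylor x| ≤ 1.2e-8 := by
    have hn : ‖((-q * x : ℝ) : ℂ)‖ = q * x := by
      rw [norm_real, Real.norm_eq_abs, abs_of_nonpos (by rw [hq]; nlinarith)]
      ring
    have h := Complex.exp_bound' (x := ((-q * x : ℝ) : ℂ)) (n := 48) (by
      rw [hn, hq]
      push_cast
      rw [div_le_iff₀ (by norm_num)]
      linarith)
    have hT : (Complex.exp ((-q * x : ℝ) : ℂ) - ∑ m ∈ Finset.range 48,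
        ((-q * x : ℝ) : ℂ) ^ m / m.factorial) = ((Real.exp (-q * x) - expTaylor x : ℝ) : ℂ) := by
      rw [expTaylor]
      push_cast
      congr 1
      refine Finset.sum_congr rfl fun k _ => ?_
      rw [hq]
      push_cast
      ring
    rw [hT, norm_real, Real.norm_eq_abs, hn] at h
    refine h.trans ?_
    have : q * x ≤ q * 4 := by rw [hq]; linarith
    calc (q * x) ^ 48 / (Nat.factorial 48) * 2 ≤ (q * 4) ^ 48 / (Nat.factorial 48) * 2 := by
          gcongr
      _ ≤ _ := by rw [hq]; norm_num [Nat.factorial]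
  calc _ ≤ |Real.exp (-Real.pi * x) - Real.exp (-q * x)| + |Real.exp (-q * x) - expTaylor x| :=
        abs_sub_le _ _ _
    _ ≤ 2.7e-7 * 0.14 + 1.2e-8 := add_le_add hA hB
    _ ≤ _ := by norm_num

-- The integral beyond 4 contributes 1.113e-6. On [1, 4], dropping the terms of ψ after the first
-- and the error of `expTaylor` contribute 0.71e-6.
open MeasureTheory Set in
theorem norm_thetaMellin_sub_integral_expTaylor_le {a : ℂ} (ha : a.re ≤ 1) :
    ‖thetaMellin a - ∫ x in (1 : ℝ)..4, (x : ℂ) ^ (a - 1) * (expTaylor x : ℂ)‖ ≤ 1.83e-6 := by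
  have hpow : ∀ x : ℝ, 1 ≤ x → ‖(x : ℂ) ^ (a - 1)‖ ≤ 1 := by
    intro x hx
    rw [norm_cpow_eq_rpow_re_of_pos (by linarith)]
    exact Real.rpow_le_one_of_one_le_of_nonpos hx (by simpa using ha)
  have hint := integrableOn_cpow_mul_thetaTail (a - 1)
  have hπ := Real.pi_gt_d4
  have hexp4 := exp_neg_four_pi_le
  have hsplit : thetaMellin a = (∫ x in (1 : ℝ)..4, (x : ℂ) ^ (a - 1) * (thetaTail x : ℂ)) +
      ∫ x in Ioi (4 : ℝ), (x : ℂ) ^ (a - 1) * (thetaTail x : ℂ) := by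
    rw [thetaMellin, intervalIntegral.integral_of_le (by norm_num : (1 : ℝ) ≤ 4),
      ← setIntegral_union (Ioc_disjoint_Ioi le_rfl) measurableSet_Ioi
        (hint.mono_set Ioc_subset_Ioi_self) (hint.mono_set (Ioi_subset_Ioi (by norm_num))),
      Ioc_union_Ioi_eq_Ioi (by norm_num)]
  have htail : ‖∫ x in Ioi (4 : ℝ), (x : ℂ) ^ (a - 1) * (thetaTail x : ℂ)‖ ≤ 1.113e-6 := by
    have hI := integrableOn_exp_mul_Ioi (a := -Real.pi) (by linarith) 4
    refine (norm_integral_le_of_norm_le (hI.const_mul 1.0004) ?_).trans ?_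
    · filter_upwards [ae_restrict_mem measurableSet_Ioi] with x hx
      have hx1 : (1 : ℝ) ≤ x := le_trans (by norm_num) (le_of_lt hx)
      rw [norm_mul, norm_real, Real.norm_of_nonneg (thetaTail_nonneg (by linarith))]
      calc _ ≤ 1 * thetaTail x :=
            mul_le_mul_of_nonneg_right (hpow x hx1) (thetaTail_nonneg (by linarith))
        _ ≤ _ := by rw [one_mul]; exact thetaTail_le_mul_exp hx1
    · rw [integral_const_mul, integral_exp_mul_Ioi (by linarith) 4, neg_div_neg_eq,
        show -Real.pi * 4 = -4 * Real.pi by ring]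
      have : Real.exp (-4 * Real.pi) / Real.pi ≤ 3.493e-6 / 3.1415 := by gcongr
      calc 1.0004 * (Real.exp (-4 * Real.pi) / Real.pi) ≤ 1.0004 * (3.493e-6 / 3.1415 : ℝ) := by
            gcongr
        _ ≤ _ := by norm_num
  have hmain : ‖(∫ x in (1 : ℝ)..4, (x : ℂ) ^ (a - 1) * (thetaTail x : ℂ)) -
      ∫ x in (1 : ℝ)..4, (x : ℂ) ^ (a - 1) * (expTaylor x : ℂ)‖ ≤ 0.71e-6 := by
    have hexpint : IntegrableOn (fun x : ℝ => Real.exp (-(4 * Real.pi) * x)) (Ioi 1) :=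
      integrableOn_exp_mul_Ioi (by linarith) 1
    have hcont : ContinuousOn (fun x : ℝ => (x : ℂ) ^ (a - 1) * (expTaylor x : ℂ))
        (uIcc (1 : ℝ) 4) := by
      rw [uIcc_of_le (by norm_num)]
      refine ((continuousOn_ofReal_cpow_Ioi (a - 1)).mono fun x hx => ?_).mul ?_
      · exact lt_of_lt_of_le zero_lt_one hx.1
      · refine Continuous.continuousOn ?_
        unfold expTaylor
        fun_prop
    rw [← intervalIntegral.integral_sub ?_ hcont.intervalIntegrable]
    · have hdom : IntervalIntegrable
          (fun x : ℝ => 2 * Real.exp (-(4 * Real.pi) * x) + 5e-8) volume 1 4 :=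
        Continuous.intervalIntegrable (by fun_prop) _ _
      refine (intervalIntegral.norm_integral_le_of_norm_le (by norm_num)
        (Eventually.of_forall fun x hx => ?_) hdom).trans ?_
      · have hx0 : 0 < x := by linarith [hx.1]
        rw [← mul_sub, norm_mul, ← ofReal_sub, norm_real, Real.norm_eq_abs]
        have h1 := abs_exp_sub_expTaylor_le hx.1.le hx.2
        have h2 := exp_le_thetaTail hx0
        have h3 := thetaTail_le hx.1.le
        rw [show -4 * Real.pi * x = -(4 * Real.pi) * x by ring] at h3
        have h4 : |thetaTail x - expTaylor x| ≤ 2 * Real.exp (-(4 * Real.pi) * x) + 5e-8 := by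
          have := Real.exp_pos (-(4 * Real.pi) * x)
          rw [abs_le] at h1 ⊢
          constructor <;> linarith [h1.1, h1.2]
        calc _ ≤ 1 * |thetaTail x - expTaylor x| :=
              mul_le_mul_of_nonneg_right (hpow x hx.1.le) (abs_nonneg _)
          _ ≤ _ := by rwa [one_mul]
      · rw [intervalIntegral.integral_add (Continuous.intervalIntegrable (by fun_prop) _ _)
          (Continuous.intervalIntegrable (by fun_prop) _ _),
          intervalIntegral.integral_const_mul, intervalIntegral.integral_const]
        have h1 : ∫ x in (1 : ℝ)..4, Real.exp (-(4 * Real.pi) * x) ≤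
            ∫ x in Ioi (1 : ℝ), Real.exp (-(4 * Real.pi) * x) := by
          rw [intervalIntegral.integral_of_le (by norm_num : (1 : ℝ) ≤ 4)]
          exact setIntegral_mono_set hexpint (Eventually.of_forall fun x => (Real.exp_pos _).le)
            (Eventually.of_forall fun x hx => Ioc_subset_Ioi_self hx)
        rw [integral_exp_mul_Ioi (by linarith) 1, neg_div_neg_eq,
          show -(4 * Real.pi) * 1 = -4 * Real.pi by ring] at h1
        have h2 : Real.exp (-4 * Real.pi) / (4 * Real.pi) ≤ 3.493e-6 / (4 * 3.1415) := by gcongr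
        rw [smul_eq_mul]
        norm_num at h1 h2 ⊢
        linarith
    · rw [intervalIntegrable_iff_integrableOn_Ioc_of_le (by norm_num)]
      exact hint.mono_set Ioc_subset_Ioi_self
  rw [hsplit, add_sub_right_comm]
  refine (norm_add_le_of_le hmain htail).trans ?_
  norm_num

open MeasureTheory Set in
theorem integral_cpow_mul_expTaylor {a : ℂ} (ha : 0 < a.re) :
    ∫ x in (1 : ℝ)..4, (x : ℂ) ^ (a - 1) * (expTaylor x : ℂ) =
      (4 : ℂ) ^ a * (∑ k ∈ Finset.range 48,
        (((-(355 / 113 : ℝ)) ^ k / k.factorial * 4 ^ k : ℝ) : ℂ) / (a + k)) -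
      ∑ k ∈ Finset.range 48, (((-(355 / 113 : ℝ)) ^ k / k.factorial : ℝ) : ℂ) / (a + k) := by
  have hne : ∀ k : ℕ, a + k ≠ 0 := by
    intro k h
    have := congrArg re h
    simp only [add_re, natCast_re, zero_re] at this
    linarith [(Nat.cast_nonneg k : (0 : ℝ) ≤ k)]
  have hterm : ∀ k : ℕ, ∫ x in (1 : ℝ)..4, (x : ℂ) ^ (a + k - 1) =
      ((4 : ℂ) ^ a * 4 ^ k - 1) / (a + k) := by
    intro k
    rw [integral_cpow]
    · rw [sub_add_cancel, ofReal_one, one_cpow, ofReal_ofNat, cpow_add _ _ (by norm_num),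
        cpow_natCast]
    · left
      simp only [sub_re, add_re, natCast_re, one_re]
      linarith [(Nat.cast_nonneg k : (0 : ℝ) ≤ k)]
  have hcongr : ∫ x in (1 : ℝ)..4, (x : ℂ) ^ (a - 1) * (expTaylor x : ℂ) =
      ∫ x in (1 : ℝ)..4, ∑ k ∈ Finset.range 48,
        (((-(355 / 113 : ℝ)) ^ k / k.factorial : ℝ) : ℂ) * (x : ℂ) ^ (a + k - 1) := by
    refine intervalIntegral.integral_congr fun x hx => ?_
    rw [uIcc_of_le (by norm_num)] at hx
    have hx0 : (x : ℂ) ≠ 0 := ofReal_ne_zero.2 (by linarith [hx.1])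
    simp only [expTaylor, ofReal_sum, Finset.mul_sum]
    refine Finset.sum_congr rfl fun k _ => ?_
    rw [add_sub_right_comm, cpow_add _ _ hx0, cpow_natCast]
    push_cast
    ring
  rw [hcongr, intervalIntegral.integral_finsetSum]
  · simp only [intervalIntegral.integral_const_mul, hterm]
    rw [Finset.mul_sum, ← Finset.sum_sub_distrib]
    refine Finset.sum_congr rfl fun k _ => ?_
    push_cast
    ring
  · intro k _
    refine IntervalIntegrable.const_mul (ContinuousOn.intervalIntegrable ?_) _
    rw [uIcc_of_le (by norm_num)]
    exact (continuousOn_ofReal_cpow_Ioi _).mono fun x hx => lt_of_lt_of_le zero_lt_one hx.1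

theorem sum_ofReal_div_add_mul_I (c : ℕ → ℝ) (n : ℕ) {b κ : ℝ} :
    ∑ k ∈ Finset.range n, (c k : ℂ) / ((b + κ * I : ℂ) + k) =
      ((∑ k ∈ Finset.range n, c k * ((k + b) / ((k + b) ^ 2 + κ ^ 2)) : ℝ) : ℂ) -
      ((∑ k ∈ Finset.range n, c k * (κ / ((k + b) ^ 2 + κ ^ 2)) : ℝ) : ℂ) * I := by
  push_cast
  rw [Finset.sum_mul, ← Finset.sum_sub_distrib]
  refine Finset.sum_congr rfl fun k _ => ?_
  have e : ((b + κ * I : ℂ) + k) = ((k + b : ℝ) : ℂ) + (κ : ℝ) * I := by push_cast; ring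
  rw [e, div_eq_mul_inv, inv_def, normSq_add_mul_I]
  simp only [map_add, map_mul, conj_ofReal, conj_I]
  push_cast
  ring

theorem four_cpow (κ : ℝ) : (4 : ℂ) ^ ((1 / 4 : ℝ) + κ * I : ℂ) =
    ((√2 * Real.cos (2 * κ * Real.log 2) : ℝ) : ℂ) +
      ((√2 * Real.sin (2 * κ * Real.log 2) : ℝ) : ℂ) * I := by
  have h2 : (4 : ℂ) = ((4 : ℝ) : ℂ) := by norm_num
  have hlog : Real.log 4 = 2 * Real.log 2 := by
    rw [show (4 : ℝ) = 2 ^ 2 by norm_num, Real.log_pow]; norm_num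
  have hsqrt : (4 : ℝ) ^ (1 / 4 : ℝ) = √2 := by
    rw [show (4 : ℝ) = 2 ^ (2 : ℝ) by norm_num, ← Real.rpow_mul (by norm_num), Real.sqrt_eq_rpow]
    norm_num
  rw [cpow_add _ _ (by norm_num), h2, ← ofReal_cpow (by norm_num), hsqrt,
    cpow_def_of_ne_zero (by norm_num), ← ofReal_log (by norm_num), hlog,
    show ((2 * Real.log 2 : ℝ) : ℂ) * (κ * I) = ((2 * κ * Real.log 2 : ℝ) : ℂ) * I by
      push_cast; ring, exp_mul_I, ← ofReal_cos, ← ofReal_sin]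
  push_cast
  ring

/-- A Taylor approximation of `∫_0^y exp (-π x) x ^ (-3 / 4) cos (κ log (x / y)) dx`, up to the
factor `y ^ (1 / 4)`. -/
noncomputable def cosSum (κ y : ℝ) : ℝ :=
  ∑ k ∈ Finset.range 48, (-(355 / 113 : ℝ)) ^ k / k.factorial * y ^ k *
    ((k + 1 / 4) / ((k + 1 / 4) ^ 2 + κ ^ 2))

/-- The analogue of `cosSum` for the sine. -/
noncomputable def sinSum (κ y : ℝ) : ℝ :=
  ∑ k ∈ Finset.range 48, (-(355 / 113 : ℝ)) ^ k / k.factorial * y ^ k *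
    (κ / ((k + 1 / 4) ^ 2 + κ ^ 2))

/-- An approximation of the real part of `thetaMellin` by elementary finite sums. -/
theorem abs_re_thetaMellin_sub_le (κ : ℝ) :
    |(thetaMellin ((1 / 4 : ℝ) + κ * I)).re -
      (√2 * (Real.cos (2 * κ * Real.log 2) * cosSum κ 4 +
        Real.sin (2 * κ * Real.log 2) * sinSum κ 4) - cosSum κ 1)| ≤ 1.83e-6 := by
  have hre : ((1 / 4 : ℝ) + κ * I : ℂ).re = 1 / 4 := by simp
  have h := norm_thetaMellin_sub_integral_expTaylor_le (a := (1 / 4 : ℝ) + κ * I)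
    (by rw [hre]; norm_num)
  rw [integral_cpow_mul_expTaylor (by rw [hre]; norm_num),
    sum_ofReal_div_add_mul_I
      (fun k => (-(355 / 113 : ℝ)) ^ k / k.factorial * 4 ^ k) 48,
    sum_ofReal_div_add_mul_I (fun k => (-(355 / 113 : ℝ)) ^ k / k.factorial) 48, four_cpow] at h
  refine le_trans (le_of_eq ?_) ((abs_re_le_norm _).trans h)
  congr 1
  simp only [cosSum, sinSum, one_pow, mul_one, sub_re, mul_re, add_re, ofReal_re, ofReal_im, I_re,
    I_im, sub_im, add_im, mul_im]
  ring

-- Here κ = t/2: 73/10 belongs to t = 14.6 and 15/4 to t = 7.5. The sums are rational numbers,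
-- evaluated exactly.
set_option maxHeartbeats 1000000 in
theorem le_cosSum_four : 4.99e-6 ≤ cosSum (73 / 10) 4 := by
  rw [cosSum]
  norm_num [Finset.sum_range_succ, Nat.factorial]

set_option maxHeartbeats 1000000 in
theorem cosSum_four_le : cosSum (73 / 10) 4 ≤ 5e-6 := by
  rw [cosSum]
  norm_num [Finset.sum_range_succ, Nat.factorial]

set_option maxHeartbeats 1000000 in
theorem sinSum_four_le : sinSum (73 / 10) 4 ≤ -6.58e-6 := by
  rw [sinSum]
  norm_num [Finset.sum_range_succ, Nat.factorial]

set_option maxHeartbeats 1000000 in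
theorem cosSum_one_le : cosSum (73 / 10) 1 ≤ -0.0023445 := by
  rw [cosSum]
  norm_num [Finset.sum_range_succ, Nat.factorial]

set_option maxHeartbeats 1000000 in
theorem cosSum_four_le' : cosSum (15 / 4) 4 ≤ -0.001937 := by
  rw [cosSum]
  norm_num [Finset.sum_range_succ, Nat.factorial]

set_option maxHeartbeats 1000000 in
theorem le_sinSum_four' : 0.001804 ≤ sinSum (15 / 4) 4 := by
  rw [sinSum]
  norm_num [Finset.sum_range_succ, Nat.factorial]

set_option maxHeartbeats 1000000 in
theorem le_cosSum_one' : -0.0101482 ≤ cosSum (15 / 4) 1 := by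
  rw [cosSum]
  norm_num [Finset.sum_range_succ, Nat.factorial]

theorem cos_mul_log_two_and_sin_mul_log_two :
    -0.7688 ≤ Real.cos (2 * (73 / 10) * Real.log 2) ∧
      Real.cos (2 * (73 / 10) * Real.log 2) ≤ 0 ∧
      Real.sin (2 * (73 / 10) * Real.log 2) ≤ -0.638 := by
  have hl1 := Real.log_two_gt_d9
  have hl2 := Real.log_two_lt_d9
  have hp1 := Real.pi_gt_d6
  have hp2 := Real.pi_lt_d6
  -- The angle slightly exceeds 3π. Halving the excess keeps the low-order Taylor bounds sharp
  -- enough; double-angle formulas then recover it.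
  obtain ⟨x, hx⟩ : ∃ x, x = (2 * (73 / 10) * Real.log 2 - 3 * Real.pi) / 2 := ⟨_, rfl⟩
  have hx1 : 0.34757 ≤ x := by rw [hx]; linarith
  have hx2 : x ≤ 0.3476 := by rw [hx]; linarith
  have hθ : 2 * (73 / 10) * Real.log 2 = 2 * x + Real.pi + 2 * Real.pi := by rw [hx]; ring
  have hxabs : |x| = x := abs_of_nonneg (by linarith)
  have hc := abs_le.1 (Real.cos_bound (x := x) (by rw [hxabs]; linarith))
  have hs := abs_le.1 (Real.sin_bound (x := x) (by rw [hxabs]; linarith))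
  rw [hxabs] at hc hs
  have hx5 : x ^ 5 ≤ 0.3476 ^ 5 := by gcongr
  have hx4 : x ^ 4 ≤ 0.3476 ^ 4 := by gcongr
  have hx3 : x ^ 3 ≤ 0.3476 ^ 3 := by gcongr
  have hx22 : 0.34757 ^ 2 ≤ x ^ 2 := by gcongr
  have hx23 : x ^ 2 ≤ 0.3476 ^ 2 := by gcongr
  have hcos1 : 0.9388 ≤ Real.cos x := by norm_num at hx4 hx23 ⊢; linarith [hc.1]
  have hcos2 : Real.cos x ≤ 0.9404 := by norm_num at hx4 hx22 ⊢; linarith [hc.2]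
  have hsin1 : 0.3404 ≤ Real.sin x := by norm_num at hx5 hx3 ⊢; linarith [hs.1]
  rw [hθ, Real.cos_add_two_pi, Real.cos_add_pi, Real.sin_add_two_pi, Real.sin_add_pi,
    Real.cos_two_mul, Real.sin_two_mul]
  have hC1 : 0.9388 ^ 2 ≤ Real.cos x ^ 2 := by gcongr
  have hC2 : Real.cos x ^ 2 ≤ 0.9404 ^ 2 := by gcongr
  have hS : 0.3404 * 0.9388 ≤ Real.sin x * Real.cos x := by gcongr
  norm_num at hC1 hC2 hS ⊢
  refine ⟨?_, ?_, ?_⟩ <;> linarith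

theorem cos_mul_log_two_and_sin_mul_log_two' :
    0.4666 ≤ Real.cos (2 * (15 / 4) * Real.log 2) ∧
      Real.sin (2 * (15 / 4) * Real.log 2) ≤ -0.8828 := by
  have hl1 := Real.log_two_gt_d9
  have hl2 := Real.log_two_lt_d9
  have hp1 := Real.pi_gt_d6
  have hp2 := Real.pi_lt_d6
  obtain ⟨x, hx⟩ : ∃ x, x = (2 * (15 / 4) * Real.log 2 - 3 * Real.pi / 2) / 2 := ⟨_, rfl⟩
  have hx1 : 0.2431 ≤ x := by rw [hx]; linarith
  have hx2 : x ≤ 0.24311 := by rw [hx]; linarith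
  have hθ : 2 * (15 / 4) * Real.log 2 = 2 * x + Real.pi / 2 + Real.pi := by rw [hx]; ring
  have hxabs : |x| = x := abs_of_nonneg (by linarith)
  have hc := abs_le.1 (Real.cos_bound (x := x) (by rw [hxabs]; linarith))
  have hs := abs_le.1 (Real.sin_bound (x := x) (by rw [hxabs]; linarith))
  rw [hxabs] at hc hs
  have hx5 : x ^ 5 ≤ 0.24311 ^ 5 := by gcongr
  have hx4 : x ^ 4 ≤ 0.24311 ^ 4 := by gcongr
  have hx3 : x ^ 3 ≤ 0.24311 ^ 3 := by gcongr
  have hx23 : x ^ 2 ≤ 0.24311 ^ 2 := by gcongr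
  have hcos1 : 0.97026 ≤ Real.cos x := by norm_num at hx4 hx23 ⊢; linarith [hc.1]
  have hsin1 : 0.24068 ≤ Real.sin x := by norm_num at hx5 hx3 ⊢; linarith [hs.1]
  rw [hθ, Real.cos_add_pi, Real.sin_add_pi, Real.cos_add_pi_div_two, Real.sin_add_pi_div_two,
    Real.cos_two_mul, Real.sin_two_mul]
  have hC1 : 0.97026 ^ 2 ≤ Real.cos x ^ 2 := by gcongr
  have hS : 0.24068 * 0.97026 ≤ Real.sin x * Real.cos x := by gcongr
  norm_num at hC1 hS ⊢
  refine ⟨?_, ?_⟩ <;> linarith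

/-- The precision is forced: 2(1/4 + 14.6²) · 0.002343 exceeds 1 by only about 4e-5, and this makes
ξ nonpositive at height 14.6. -/
theorem le_re_thetaMellin : 0.002343 ≤ (thetaMellin ((1 / 4 : ℝ) + (73 / 10 : ℝ) * I)).re := by
  have h := (abs_le.1 (abs_re_thetaMellin_sub_le (73 / 10))).1
  have hA1 := le_cosSum_four
  have hA2 := cosSum_four_le
  have hB1 := sinSum_four_le
  have hS1 := cosSum_one_le
  obtain ⟨hC1, hC2, hD⟩ := cos_mul_log_two_and_sin_mul_log_two
  generalize cosSum (73 / 10) 4 = A at *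
  generalize sinSum (73 / 10) 4 = B at *
  generalize cosSum (73 / 10) 1 = S at *
  generalize (thetaMellin ((1 / 4 : ℝ) + (73 / 10 : ℝ) * I)).re = R at *
  generalize Real.cos (2 * (73 / 10) * Real.log 2) = C at *
  generalize Real.sin (2 * (73 / 10) * Real.log 2) = D at *
  have hsq : 1.41 ≤ √2 := Real.le_sqrt_of_sq_le (by norm_num)
  have h1 : -C * A ≤ 0.7688 * 5e-6 := mul_le_mul (by linarith) hA2 (by linarith) (by norm_num)
  have h2 : 0.638 * 6.58e-6 ≤ -D * -B :=
    mul_le_mul (by linarith) (by linarith) (by norm_num) (by linarith)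
  have h3 : 3.5e-7 ≤ C * A + D * B := by
    norm_num at h1 h2 ⊢; linarith
  have h4 : 1.41 * 3.5e-7 ≤ √2 * (C * A + D * B) :=
    mul_le_mul hsq h3 (by norm_num) (by linarith)
  norm_num at h h4 hS1 ⊢
  linarith

theorem re_thetaMellin_le : (thetaMellin ((1 / 4 : ℝ) + (15 / 4 : ℝ) * I)).re ≤ 0.006621 := by
  have h := (abs_le.1 (abs_re_thetaMellin_sub_le (15 / 4))).2
  have hA1 := cosSum_four_le'
  have hB1 := le_sinSum_four'
  have hS1 := le_cosSum_one'
  obtain ⟨hC, hD⟩ := cos_mul_log_two_and_sin_mul_log_two'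
  generalize cosSum (15 / 4) 4 = A at *
  generalize sinSum (15 / 4) 4 = B at *
  generalize cosSum (15 / 4) 1 = S at *
  generalize (thetaMellin ((1 / 4 : ℝ) + (15 / 4 : ℝ) * I)).re = R at *
  generalize Real.cos (2 * (15 / 4) * Real.log 2) = C at *
  generalize Real.sin (2 * (15 / 4) * Real.log 2) = D at *
  have hsq : 1.414 ≤ √2 := Real.le_sqrt_of_sq_le (by norm_num)
  have h1 : 0.4666 * 0.001937 ≤ C * -A := mul_le_mul hC (by linarith) (by norm_num) (by linarith)
  have h2 : 0.8828 * 0.001804 ≤ -D * B := mul_le_mul (by linarith) hB1 (by norm_num) (by linarith)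
  have h3 : 0.002496 ≤ -(C * A + D * B) := by norm_num at h1 h2 ⊢; linarith
  have h4 : √2 * (C * A + D * B) ≤ -(1.414 * 0.002496) := by
    have := mul_le_mul hsq h3 (by norm_num) (by linarith)
    rw [mul_neg] at this
    linarith
  norm_num at h h4 hS1 ⊢
  linarith

/-! ### The xi function and its special values -/

/-- Twice the Riemann xi function. -/
noncomputable def doubleXi (s : ℂ) : ℂ := 1 - s * (1 - s) * completedRiemannZeta₀ s

theorem differentiable_doubleXi : Differentiable ℂ doubleXi := by
  have := differentiable_completedZeta₀
  unfold doubleXi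
  fun_prop

theorem doubleXi_one_sub (s : ℂ) : doubleXi (1 - s) = doubleXi s := by
  rw [doubleXi, doubleXi, completedRiemannZeta₀_one_sub]
  ring

open ComplexConjugate in
theorem doubleXi_conj (s : ℂ) : doubleXi (conj s) = conj (doubleXi s) := by
  simp [doubleXi, completedRiemannZeta₀_conj]

theorem doubleXi_eq {s : ℂ} (h0 : s ≠ 0) (h1 : s ≠ 1) :
    doubleXi s = -(s * (1 - s)) * completedRiemannZeta s := by
  have h1' : 1 - s ≠ 0 := sub_ne_zero.2 h1.symm
  rw [completedRiemannZeta_eq, doubleXi]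
  field_simp
  ring

theorem riemannZeta_eq_zero_of_doubleXi_eq_zero {s : ℂ} (h : doubleXi s = 0) :
    riemannZeta s = 0 ∧ 0 < s.re ∧ s.re < 1 := by
  have key : ∀ w : ℂ, doubleXi w = 0 → riemannZeta w = 0 := by
    intro w hw
    have h0 : w ≠ 0 := by rintro rfl; simp [doubleXi] at hw
    have h1 : w ≠ 1 := by rintro rfl; simp [doubleXi] at hw
    rw [doubleXi_eq h0 h1, neg_mul, neg_eq_zero, mul_eq_zero,
      or_iff_right (mul_ne_zero h0 (sub_ne_zero.2 h1.symm))] at hw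
    rw [riemannZeta_def_of_ne_zero h0, hw, zero_div]
  have hs := key s h
  have hs' := key (1 - s) (by rwa [doubleXi_one_sub])
  refine ⟨hs, ?_, ?_⟩
  · by_contra! hre
    exact riemannZeta_ne_zero_of_one_le_re (s := 1 - s) (by simpa using hre) hs'
  · by_contra! hre
    exact riemannZeta_ne_zero_of_one_le_re hre hs

theorem doubleXi_eq_zero_of_riemannZeta_eq_zero {s : ℂ} (h : riemannZeta s = 0)
    (htriv : ¬∃ n : ℕ, s = -2 * (n + 1)) : doubleXi s = 0 := by
  have h0 : s ≠ 0 := by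
    rintro rfl
    rw [riemannZeta_zero] at h
    norm_num at h
  have h1 : s ≠ 1 := by
    rintro rfl
    exact riemannZeta_one_ne_zero h
  rw [riemannZeta_def_of_ne_zero h0, div_eq_zero_iff] at h
  rcases h with h | h
  · rw [doubleXi_eq h0 h1, h, mul_zero]
  · obtain ⟨n, hn⟩ := Gammaℝ_eq_zero_iff.1 h
    rcases n with _ | n
    · simp at hn
      exact absurd hn h0
    · refine absurd ⟨n, ?_⟩ htriv
      rw [hn]
      push_cast
      ring

/-- On the line (1 - s)/2 is the conjugate of s/2, so the two Mellin terms add up to twice a real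
part. -/
theorem doubleXi_critical_line (t : ℝ) : doubleXi (1 / 2 + t * I) =
    ((1 - (1 / 4 + t ^ 2) * (2 * (thetaMellin ((1 / 4 : ℝ) + (t / 2 : ℝ) * I)).re) : ℝ) : ℂ) := by
  have e1 : (1 / 2 + t * I : ℂ) / 2 = (1 / 4 : ℝ) + (t / 2 : ℝ) * I := by push_cast; ring
  have e2 : (1 - (1 / 2 + t * I : ℂ)) / 2 =
      (starRingEnd ℂ) ((1 / 4 : ℝ) + (t / 2 : ℝ) * I : ℂ) := by
    simp only [map_add, map_mul, conj_ofReal, conj_I]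
    push_cast; ring
  rw [doubleXi, completedRiemannZeta₀_eq_thetaMellin, e1, e2, thetaMellin_conj, add_conj]
  push_cast
  ring_nf
  rw [I_sq]
  ring

theorem doubleXi_half : ∃ r : ℝ, doubleXi (1 / 2) = r ∧ 0 < r ∧ r ≤ 1 := by
  have h := doubleXi_critical_line 0
  have hle := norm_completedRiemannZeta₀_le (s := 1 / 2) (by norm_num) (by norm_num)
  rw [ofReal_zero, zero_mul, add_zero] at h
  refine ⟨_, h, ?_, ?_⟩
  · have h2 : (1 : ℝ) - ‖(1 / 2 : ℂ) * (1 - 1 / 2) * completedRiemannZeta₀ (1 / 2)‖ ≤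
        (doubleXi (1 / 2)).re := by
      rw [doubleXi, sub_re, one_re]
      linarith [re_le_norm ((1 / 2 : ℂ) * (1 - 1 / 2) * completedRiemannZeta₀ (1 / 2))]
    rw [h, ofReal_re, norm_mul] at h2
    have : ‖(1 / 2 : ℂ) * (1 - 1 / 2)‖ = 1 / 4 := by norm_num
    rw [this] at h2
    linarith
  · have hpos : 0 ≤ (thetaMellin ((1 / 4 : ℝ) + (0 / 2 : ℝ) * I)).re := by
      rw [zero_div, ofReal_zero, zero_mul, add_zero, thetaMellin_ofReal, ofReal_re]
      refine MeasureTheory.setIntegral_nonneg measurableSet_Ioi fun x hx => ?_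
      have hx0 : (0 : ℝ) < x := zero_lt_one.trans hx
      exact mul_nonneg (by positivity) (thetaTail_nonneg hx0)
    linarith

theorem lt_doubleXi_fifteen_halves :
    ∃ r : ℝ, doubleXi (1 / 2 + (15 / 2 : ℝ) * I) = r ∧ 0.2518 ≤ r := by
  refine ⟨_, doubleXi_critical_line _, ?_⟩
  have h := re_thetaMellin_le
  rw [show (15 / 2 / 2 : ℝ) = 15 / 4 by norm_num]
  norm_num at h ⊢
  linarith

/-- The zeta function has a zero of height at most `14.6` on the critical line. -/
theorem exists_doubleXi_eq_zero : ∃ t : ℝ, 0 ≤ t ∧ t ≤ 14.6 ∧ doubleXi (1 / 2 + t * I) = 0 := by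
  set φ : ℝ → ℝ := fun t => (doubleXi (1 / 2 + t * I)).re with hφ
  have hcont : Continuous φ := by
    have := differentiable_doubleXi.continuous
    exact continuous_re.comp (this.comp (by fun_prop))
  have h1 : 0 ≤ φ 7.5 := by
    obtain ⟨r, hr, hr2⟩ := lt_doubleXi_fifteen_halves
    rw [hφ]
    simp only
    rw [show (7.5 : ℝ) = 15 / 2 by norm_num, hr, ofReal_re]
    linarith
  have h2 : φ 14.6 ≤ 0 := by
    rw [hφ]
    simp only
    rw [doubleXi_critical_line, ofReal_re, show (14.6 / 2 : ℝ) = 73 / 10 by norm_num]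
    have h := le_re_thetaMellin
    norm_num at h ⊢
    linarith
  obtain ⟨t, ht, ht0⟩ := intermediate_value_Icc' (by norm_num : (7.5 : ℝ) ≤ 14.6)
    hcont.continuousOn ⟨h2, h1⟩
  refine ⟨t, le_trans (by norm_num) ht.1, ht.2, ?_⟩
  rw [hφ] at ht0
  simp only at ht0
  rw [doubleXi_critical_line, ofReal_re] at ht0
  rw [doubleXi_critical_line, ht0, ofReal_zero]

/-- The value is 56 · (Γ(4)/π⁴) · ζ(8), and the first term of the series gives ζ(8) ≥ 1. -/
theorem le_norm_doubleXi_eight : 3.449 ≤ ‖doubleXi 8‖ := by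
  have hzeta : 1 ≤ ‖riemannZeta 8‖ := by
    have h := zeta_nat_eq_tsum_of_gt_one (k := 8) (by norm_num)
    have hsum : Summable fun n : ℕ => 1 / (n : ℝ) ^ 8 :=
      Real.summable_one_div_nat_pow.2 (by norm_num)
    have hcast : riemannZeta 8 = ((∑' n : ℕ, 1 / (n : ℝ) ^ 8 : ℝ) : ℂ) := by
      rw [ofReal_tsum]
      push_cast at h ⊢
      exact h
    have h1 := hsum.le_tsum 1 fun n _ => by positivity
    rw [hcast, norm_real, Real.norm_eq_abs]
    refine le_trans ?_ (le_abs_self _)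
    simpa using h1
  have hΛ : completedRiemannZeta 8 = Gammaℝ 8 * riemannZeta 8 := by
    rw [riemannZeta_def_of_ne_zero (by norm_num)]
    have : Gammaℝ 8 ≠ 0 := Gammaℝ_ne_zero_of_re_pos (by norm_num)
    field_simp
  have hG : Gammaℝ 8 = ((6 / Real.pi ^ 4 : ℝ) : ℂ) := by
    rw [Gammaℝ_def, show (-8 / 2 : ℂ) = ((-4 : ℤ) : ℂ) by norm_num, cpow_intCast,
      show (8 / 2 : ℂ) = ((3 : ℕ) : ℂ) + 1 by norm_num, Complex.Gamma_nat_eq_factorial]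
    norm_num [Nat.factorial, zpow_neg]
    ring
  rw [doubleXi_eq (by norm_num) (by norm_num), hΛ, hG, norm_mul, norm_mul, norm_real,
    Real.norm_of_nonneg (by positivity)]
  have h56 : ‖-((8 : ℂ) * (1 - 8))‖ = 56 := by norm_num
  rw [h56]
  have hπ : Real.pi ^ 4 ≤ 3.1416 ^ 4 := by
    gcongr
    exact Real.pi_lt_d4.le
  have h6 : 6 / 3.1416 ^ 4 ≤ 6 / Real.pi ^ 4 := by gcongr
  have h7 : 6 / 3.1416 ^ 4 * 1 ≤ 6 / Real.pi ^ 4 * ‖riemannZeta 8‖ :=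
    mul_le_mul h6 hzeta (by norm_num) (by positivity)
  norm_num at h7 ⊢
  linarith

/-! ### Xi as a function of the square of s - 1/2 -/

/-- The even function `z ↦ doubleXi (1 / 2 + z)` as a function of `z ^ 2`. -/
noncomputable def xiSq (v : ℂ) : ℂ := doubleXi (1 / 2 + v ^ (1 / 2 : ℂ))

theorem xiSq_sq (z : ℂ) : xiSq (z ^ 2) = doubleXi (1 / 2 + z) := by
  have h : ((z ^ 2) ^ (1 / 2 : ℂ)) ^ 2 = z ^ 2 := by
    rw [← cpow_nat_mul]
    norm_num
  rw [xiSq]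
  rcases sq_eq_sq_iff_eq_or_eq_neg.1 h with h | h
  · rw [h]
  · rw [h, ← doubleXi_one_sub]
    ring_nf

/-- By evenness the branch of the root is irrelevant: the principal branch serves off the negative
axis, i(-v)^(1/2) off the positive one, and 0 is a removable singularity. -/
theorem differentiable_xiSq : Differentiable ℂ xiSq := by
  have hslit : ∀ v ∈ slitPlane, DifferentiableAt ℂ xiSq v := by
    intro v hv
    have h1 : DifferentiableAt ℂ (fun v : ℂ => v ^ (1 / 2 : ℂ)) v :=
      differentiableAt_id.cpow_const hv
    exact (differentiable_doubleXi _).comp v (h1.const_add (1 / 2))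
  have hslit' : ∀ v, -v ∈ slitPlane → DifferentiableAt ℂ xiSq v := by
    intro v hv
    have e : xiSq = fun v => doubleXi (1 / 2 + I * (-v) ^ (1 / 2 : ℂ)) := by
      ext v
      have h : (I * (-v) ^ (1 / 2 : ℂ)) ^ 2 = v := by
        rw [mul_pow, I_sq, ← cpow_nat_mul]
        norm_num
      rw [← xiSq_sq, h]
    rw [e]
    have h1 : DifferentiableAt ℂ (fun v : ℂ => (-v) ^ (1 / 2 : ℂ)) v :=
      differentiableAt_id.neg.cpow_const hv
    exact (differentiable_doubleXi _).comp v ((h1.const_mul I).const_add (1 / 2))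
  have hne : ∀ v, v ≠ 0 → DifferentiableAt ℂ xiSq v := by
    intro v hv
    by_cases h : v ∈ slitPlane
    · exact hslit v h
    · refine hslit' v ?_
      rw [mem_slitPlane_iff] at h ⊢
      push Not at h
      left
      rw [neg_re]
      have : v.re ≠ 0 := fun h0 => hv (Complex.ext h0 h.2)
      have := lt_of_le_of_ne h.1 this
      linarith
  have hcont : ContinuousAt xiSq 0 := by
    have h1 : ContinuousAt (fun v : ℂ => v ^ (1 / 2 : ℂ)) 0 :=
      continuousAt_cpow_const_of_re_pos (Or.inl le_rfl) (by norm_num)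
    exact differentiable_doubleXi.continuous.continuousAt.comp (continuousAt_const.add h1)
  rw [← differentiableOn_univ]
  exact (differentiableOn_compl_singleton_and_continuousAt_iff univ_mem).1
    ⟨fun v hv => (hne v hv.2).differentiableWithinAt, hcont⟩

/-- With p = 1 + √r, the bound p^p for the Mellin transform has logarithm of order √r log r, which
is o(r). -/
theorem eventually_norm_xiSq_le {ε : ℝ} (hε : 0 < ε) :
    ∀ᶠ r : ℝ in atTop, ∀ v, ‖v‖ = r → ‖xiSq v‖ ≤ Real.exp (ε * r) := by
  have hp : Tendsto (fun r : ℝ => 1 + √r) atTop atTop :=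
    tendsto_atTop_add_const_left _ _ Real.tendsto_sqrt_atTop
  have hlog : ∀ᶠ p : ℝ in atTop, ‖Real.log p‖ ≤ ε / 12 * ‖p‖ :=
    Real.isLittleO_log_id_atTop.bound (by positivity)
  filter_upwards [hp.eventually hlog, hp.eventually_ge_atTop 2, eventually_ge_atTop 0]
    with r hr hr2 hr0 v hv
  set p := 1 + √r with hpdef
  have hp0 : 0 < p := by linarith
  set z := v ^ (1 / 2 : ℂ) with hz
  have hz2 : ‖z‖ = √r := by
    have h : z ^ 2 = v := by
      rw [hz, ← cpow_nat_mul]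
      norm_num
    rw [← hv, ← h, norm_pow, Real.sqrt_sq (norm_nonneg _)]
  have hs : ‖1 / 2 + z‖ ≤ p := by
    refine (norm_add_le _ _).trans ?_
    rw [hz2]
    norm_num
    linarith
  have hs' : ‖1 - (1 / 2 + z)‖ ≤ p := by
    rw [show 1 - (1 / 2 + z) = 1 / 2 - z by ring]
    refine (norm_sub_le _ _).trans ?_
    rw [hz2]
    norm_num
    linarith
  have hhalf : ∀ s : ℂ, ‖s‖ ≤ p → ‖thetaMellin (s / 2)‖ ≤ p ^ p := fun s h =>
    norm_thetaMellin_le_rpow_self (by linarith) (by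
      rw [norm_div]
      norm_num
      linarith)
  have hΛ : ‖completedRiemannZeta₀ (1 / 2 + z)‖ ≤ p ^ p + p ^ p := by
    rw [completedRiemannZeta₀_eq_thetaMellin]
    exact norm_add_le_of_le (hhalf _ hs) (hhalf _ hs')
  have hpp : 1 ≤ p ^ p := Real.one_le_rpow (by linarith) hp0.le
  have h1 : ‖xiSq v‖ ≤ 1 + p * p * (p ^ p + p ^ p) := by
    rw [xiSq, ← hz, doubleXi]
    refine (norm_sub_le _ _).trans ?_
    rw [norm_one, norm_mul, norm_mul]
    gcongr
  have h2 : 1 + p * p * (p ^ p + p ^ p) ≤ p ^ 4 * p ^ p := by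
    have h4 : 4 ≤ p ^ 2 := by nlinarith
    have h5 : 4 * p ^ 2 ≤ p ^ 4 := by nlinarith
    have h6 : 4 * p ^ 2 * p ^ p ≤ p ^ 4 * p ^ p := by gcongr
    have h7 : 1 * 1 ≤ p ^ 2 * p ^ p := mul_le_mul (by linarith) hpp (by norm_num) (by positivity)
    nlinarith
  refine (h1.trans h2).trans ?_
  have hl0 : 0 ≤ Real.log p := Real.log_nonneg (by linarith)
  rw [Real.norm_of_nonneg hl0, Real.norm_of_nonneg hp0.le] at hr
  have e : p ^ 4 * p ^ p = Real.exp ((4 + p) * Real.log p) := by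
    rw [add_mul, Real.exp_add, Real.rpow_def_of_pos hp0, mul_comm (Real.log p) p]
    congr 1
    rw [show (4 : ℝ) = ((4 : ℕ) : ℝ) by norm_num, Real.exp_nat_mul, Real.exp_log hp0]
  rw [e]
  apply Real.exp_le_exp.2
  have hr' : r = (p - 1) ^ 2 := by rw [hpdef, add_sub_cancel_left, Real.sq_sqrt hr0]
  calc (4 + p) * Real.log p ≤ (3 * p) * (ε / 12 * p) :=
        mul_le_mul (by linarith) hr hl0 (by linarith)
    _ = ε * (p ^ 2 / 4) := by ring
    _ ≤ ε * r := by
      rw [hr']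
      gcongr
      nlinarith

/-! ### Excluding low zeros off the critical line -/

/-- Zeros of `doubleXi`, in terms of the square of the distance to `1 / 2`. -/
theorem norm_sq_of_doubleXi_eq_zero {z : ℂ} (h : doubleXi (1 / 2 + z) = 0) :
    41.99 ≤ ‖z ^ 2‖ ∧ ‖z ^ 2‖ ^ 2 - 2 * ‖z ^ 2‖ ≤ ((z ^ 2) ^ 2).re ∧ |z.re| < 1 / 2 := by
  obtain ⟨-, h0, h1⟩ := riemannZeta_eq_zero_of_doubleXi_eq_zero h
  have hre : (1 / 2 + z : ℂ).re = 1 / 2 + z.re := by simp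
  have hΛ := norm_completedRiemannZeta₀_le h0.le h1.le
  rw [hre] at h0 h1
  have habs : |z.re| < 1 / 2 := abs_lt.2 ⟨by linarith, by linarith⟩
  refine ⟨?_, ?_, habs⟩
  · have h2 : (1 / 4 - z ^ 2) * completedRiemannZeta₀ (1 / 2 + z) = 1 := by
      rw [doubleXi, sub_eq_zero] at h
      refine Eq.trans ?_ h.symm
      ring
    have h3 := congrArg norm h2
    rw [norm_mul, norm_one] at h3
    have h4 : ‖(1 / 4 - z ^ 2 : ℂ)‖ ≤ 1 / 4 + ‖z ^ 2‖ := by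
      refine (norm_sub_le _ _).trans (le_of_eq ?_)
      norm_num
    have h5 : 1 ≤ (1 / 4 + ‖z ^ 2‖) * 0.02367 :=
      h3.symm.le.trans (mul_le_mul h4 hΛ (norm_nonneg _) (by positivity))
    linarith
  · have e1 : ‖z ^ 2‖ = z.re ^ 2 + z.im ^ 2 := by
      rw [norm_pow, Complex.sq_norm, normSq_apply]
      ring
    have e2 : ((z ^ 2) ^ 2).re = (z.re ^ 2 - z.im ^ 2) ^ 2 - 4 * (z.re ^ 2 * z.im ^ 2) := by
      simp only [pow_two, mul_re, mul_im]
      ring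
    have hb : z.re ^ 2 ≤ 1 / 4 := by
      rw [← sq_abs]
      nlinarith [abs_nonneg z.re]
    rw [e1, e2]
    -- The defect |z²|² - Re z⁴ is 8 (Re z)² (Im z)², at most 2 (Im z)².
    nlinarith [mul_nonneg (sub_nonneg.2 hb) (sq_nonneg z.im), sq_nonneg z.re]

theorem norm_one_sub_div_sq_sq {C : ℝ} {w : ℂ} (hw : w ≠ 0) :
    ‖1 - (C : ℂ) / w ^ 2‖ ^ 2 = 1 - C * (2 * (w ^ 2).re - C) / ‖w‖ ^ 4 := by
  have hw2 : w ^ 2 ≠ 0 := pow_ne_zero 2 hw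
  have hn : 0 < ‖w‖ := norm_pos_iff.2 hw
  rw [show 1 - (C : ℂ) / w ^ 2 = (w ^ 2 - C) / w ^ 2 by field_simp, norm_div, div_pow,
    show ‖w‖ ^ 4 = ‖w ^ 2‖ ^ 2 by rw [norm_pow]; ring, eq_sub_iff_add_eq, ← add_div,
    div_eq_one_iff_eq (by positivity), Complex.sq_norm, Complex.sq_norm, normSq_apply, normSq_apply]
  simp only [sub_re, sub_im, ofReal_re, ofReal_im]
  ring

theorem norm_one_sub_div_sq_le_one {z : ℂ} (h : doubleXi (1 / 2 + z) = 0) :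
    ‖1 - (((225 / 4 : ℝ) ^ 2 : ℝ) : ℂ) / (z ^ 2) ^ 2‖ ≤ 1 := by
  obtain ⟨h1, h2, -⟩ := norm_sq_of_doubleXi_eq_zero h
  have hne : z ^ 2 ≠ 0 := norm_pos_iff.1 (by linarith)
  rw [← sq_le_one_iff₀ (norm_nonneg _), norm_one_sub_div_sq_sq hne, sub_le_self_iff]
  have : 0 ≤ 2 * ((z ^ 2) ^ 2).re - (225 / 4 : ℝ) ^ 2 := by nlinarith
  positivity

theorem norm_one_sub_div_sq_le {z : ℂ} (h : doubleXi (1 / 2 + z) = 0) (him : |z.im| ≤ 14.6) :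
    ‖1 - (((225 / 4 : ℝ) ^ 2 : ℝ) : ℂ) / (z ^ 2) ^ 2‖ ^ 2 ≤ 0.8672 := by
  obtain ⟨h1, h2, h3⟩ := norm_sq_of_doubleXi_eq_zero h
  have hne : z ^ 2 ≠ 0 := norm_pos_iff.1 (by linarith)
  -- 213.41 = 14.6² + 1/4.
  have hm : ‖z ^ 2‖ ≤ 213.41 := by
    rw [norm_pow, Complex.sq_norm, normSq_apply, ← pow_two, ← pow_two, ← sq_abs z.re, ← sq_abs z.im]
    nlinarith [abs_nonneg z.re, abs_nonneg z.im]
  rw [norm_one_sub_div_sq_sq hne]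
  set m := ‖z ^ 2‖
  have hm0 : 0 < m := by linarith
  have key : 0.1328 * m ^ 4 ≤ (225 / 4 : ℝ) ^ 2 * (2 * (m ^ 2 - 2 * m) - (225 / 4 : ℝ) ^ 2) := by
    -- The product is an approximate factorisation of the difference of the two sides.
    have := mul_nonneg (mul_nonneg (sub_nonneg.2 hm) (sub_nonneg.2 h1))
      (by positivity : 0 ≤ 0.1328 * m ^ 2 + 33.9 * m + 1130)
    nlinarith
  have : 0.1328 ≤
      (225 / 4 : ℝ) ^ 2 * (2 * ((z ^ 2) ^ 2).re - (225 / 4 : ℝ) ^ 2) / m ^ 4 := by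
    rw [le_div_iff₀ (by positivity)]
    refine key.trans ?_
    gcongr
  linarith

open ComplexConjugate in
/-- The zeros off the critical line have height greater than `14.6`. -/
theorem lt_abs_im_of_doubleXi_eq_zero {s : ℂ} (h : doubleXi s = 0) (hs : s.re ≠ 1 / 2) :
    14.6 < |s.im| := by
  by_contra! him
  obtain ⟨z, rfl⟩ : ∃ z, s = 1 / 2 + z := ⟨s - 1 / 2, by ring⟩
  have him' : |z.im| ≤ 14.6 := by simpa using him
  have hre : z.re ≠ 0 := by
    intro h0
    apply hs
    simp [h0]
  obtain ⟨h1, h2, h3⟩ := norm_sq_of_doubleXi_eq_zero h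
  have him0 : z.im ≠ 0 := by
    intro h0
    rw [norm_pow, Complex.sq_norm, normSq_apply, h0] at h1
    rw [abs_lt] at h3
    nlinarith
  have hconj : doubleXi (1 / 2 + conj z) = 0 := by
    have e : (1 / 2 + conj z : ℂ) = conj (1 / 2 + z) := by simp [map_ofNat]
    rw [e, doubleXi_conj, h, map_zero]
  -- As z is neither real nor purely imaginary, z and its conjugate give two different zeros of
  -- `xiSq`.
  have hab : z ^ 2 ≠ (conj z) ^ 2 := by
    intro h0
    have := congrArg im h0
    simp only [pow_two, mul_im, conj_re, conj_im] at this
    have h4 : z.re * z.im = 0 := by linarith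
    exact (mul_ne_zero hre him0) h4
  have hx0 : xiSq 0 = doubleXi (1 / 2) := by simpa using xiSq_sq 0
  obtain ⟨r, hr, hr0, hr1⟩ := doubleXi_half
  obtain ⟨q, hq, hq0⟩ := lt_doubleXi_fifteen_halves
  have hc : (((225 / 4 : ℝ) : ℂ)) ^ 2 = (((225 / 4 : ℝ) ^ 2 : ℝ) : ℂ) := by push_cast; rfl
  have hmain := norm_mul_norm_neg_le_of_zeros differentiable_xiSq
    (by rw [hx0, hr]; exact_mod_cast hr0.ne') (fun ε hε => eventually_norm_xiSq_le hε)
    (c := ((225 / 4 : ℝ) : ℂ)) (fun w hw => by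
      obtain ⟨u, rfl⟩ : ∃ u : ℂ, w = u ^ 2 := ⟨w ^ (1 / 2 : ℂ), by
        rw [← cpow_nat_mul]
        norm_num⟩
      rw [hc]
      exact norm_one_sub_div_sq_le_one (by rwa [← xiSq_sq]))
    (by rw [xiSq_sq]; exact h) (by rw [xiSq_sq]; exact hconj) hab
  have e8 : xiSq ((225 / 4 : ℝ) : ℂ) = doubleXi 8 := by
    have := xiSq_sq (15 / 2)
    norm_num at this ⊢
    exact this
  have e15 : xiSq (-((225 / 4 : ℝ) : ℂ)) = doubleXi (1 / 2 + (15 / 2 : ℝ) * I) := by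
    rw [← xiSq_sq, mul_pow, I_sq]
    push_cast
    norm_num
  rw [hx0, hr, e8, e15, hq, hc, norm_real, norm_real, Real.norm_of_nonneg hr0.le,
    Real.norm_of_nonneg (by linarith)] at hmain
  have ha := norm_one_sub_div_sq_le h him'
  have hb := norm_one_sub_div_sq_le hconj (by rwa [conj_im, abs_neg])
  have h8 := le_norm_doubleXi_eight
  have hr2 : r ^ 2 ≤ 1 := pow_le_one₀ hr0.le hr1
  generalize ‖1 - (((225 / 4 : ℝ) ^ 2 : ℝ) : ℂ) / (z ^ 2) ^ 2‖ = x at *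
  generalize ‖1 - (((225 / 4 : ℝ) ^ 2 : ℝ) : ℂ) / (conj z ^ 2) ^ 2‖ = y at *
  have hxy : x * y ≤ 0.8672 := by nlinarith [sq_nonneg (x - y)]
  -- The left side exceeds 0.868, against the upper bound 0.8672.
  have hl : 3.449 * 0.2518 ≤ ‖doubleXi 8‖ * q := mul_le_mul h8 hq0 (by norm_num) (norm_nonneg _)
  have hu : r ^ 2 * (x * y) ≤ 0.8672 := by
    rcases le_or_gt (x * y) 0 with h0 | h0
    · exact (mul_nonpos_of_nonneg_of_nonpos (sq_nonneg r) h0).trans (by norm_num)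
    · exact (mul_le_of_le_one_left h0.le hr2).trans hxy
  norm_num at hl hu hmain
  linarith

-- Minimal elements of Z

-- The elements of Z below s lie in a compact box, which contains finitely many zeros.
attribute [local instance] coordOrder in
theorem exists_mem_minimalZetaZeros_le {s : ℂ} (hs : s ∈ zetaZeros) :
    ∃ m ∈ minimalZetaZeros, m.re ≤ s.re ∧ m.im ≤ s.im := by
  have hfin : {z ∈ zetaZeros | z ≤ s}.Finite := by
    have hK : IsCompact (Set.Icc 0 s.re ×ℂ Set.Icc 0 s.im) := isCompact_Icc.reProdIm isCompact_Icc
    refine hK.inter_riemannZetaZeros_finite.subset ?_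
    rintro z ⟨⟨h0, hz⟩, hzs⟩
    exact ⟨⟨⟨h0.1, hzs.1⟩, ⟨h0.2, hzs.2⟩⟩, hz⟩
  obtain ⟨m, hms, hm⟩ := hfin.exists_le_minimal (a := s) ⟨hs, le_rfl⟩
  refine ⟨m, ⟨hm.1.1, fun z hz hzm => ?_⟩, hm.1.2.1, hm.1.2.2⟩
  exact hm.2 ⟨hz, hzm.trans hms⟩ hzm

theorem mem_zetaZeros_iff {s : ℂ} : s ∈ zetaZeros ↔ (0 ≤ s.re ∧ 0 ≤ s.im) ∧ riemannZeta s = 0 :=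
  Iff.rfl

theorem doubleXi_eq_zero_of_mem_zetaZeros {s : ℂ} (hs : s ∈ zetaZeros) : doubleXi s = 0 := by
  rw [mem_zetaZeros_iff] at hs
  refine doubleXi_eq_zero_of_riemannZeta_eq_zero hs.2 ?_
  rintro ⟨n, rfl⟩
  have h := hs.1.1
  have e : (-2 * ((n : ℂ) + 1)) = ((-2 * ((n : ℝ) + 1) : ℝ) : ℂ) := by push_cast; ring
  rw [e, ofReal_re] at h
  linarith [(Nat.cast_nonneg n : (0 : ℝ) ≤ n)]

/-- If the Riemann hypothesis fails, some zero in the quadrant lies to the left of the critical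
line. -/
theorem exists_mem_zetaZeros_re_lt (h : ¬RiemannHypothesis) : ∃ s ∈ zetaZeros, s.re < 1 / 2 := by
  rw [RiemannHypothesis] at h
  push Not at h
  obtain ⟨s, hζ, htriv, -, hre⟩ := h
  have hs := doubleXi_eq_zero_of_riemannZeta_eq_zero hζ (by simpa using htriv)
  obtain ⟨u, hu, hure⟩ : ∃ u, doubleXi u = 0 ∧ u.re < 1 / 2 := by
    rcases lt_or_gt_of_ne hre with h | h
    · exact ⟨s, hs, h⟩
    · refine ⟨1 - s, by rwa [doubleXi_one_sub], ?_⟩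
      rw [sub_re, one_re]
      linarith
  obtain ⟨w, hw, hwre, hwim⟩ : ∃ w, doubleXi w = 0 ∧ w.re < 1 / 2 ∧ 0 ≤ w.im := by
    rcases le_or_gt 0 u.im with h | h
    · exact ⟨u, hu, hure, h⟩
    · refine ⟨(starRingEnd ℂ) u, by rw [doubleXi_conj, hu, map_zero], hure, ?_⟩
      rw [conj_im]
      linarith
  obtain ⟨hζw, h0, -⟩ := riemannZeta_eq_zero_of_doubleXi_eq_zero hw
  exact ⟨w, mem_zetaZeros_iff.2 ⟨⟨h0.le, hwim⟩, hζw⟩, hwre⟩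

theorem corollary3p1 : ¬ RiemannHypothesis ↔ 2 ≤ minimalZetaZeros.encard := by
  constructor
  · intro h
    obtain ⟨s, hs, hsre⟩ := exists_mem_zetaZeros_re_lt h
    obtain ⟨t, ht0, ht, hzero⟩ := exists_doubleXi_eq_zero
    have hline : (1 / 2 + t * I : ℂ) ∈ zetaZeros := by
      refine mem_zetaZeros_iff.2 ⟨⟨by norm_num, by simpa using ht0⟩, ?_⟩
      exact (riemannZeta_eq_zero_of_doubleXi_eq_zero hzero).1
    obtain ⟨m, hm, hmre, -⟩ := exists_mem_minimalZetaZeros_le hs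
    obtain ⟨k, hk, -, hkim⟩ := exists_mem_minimalZetaZeros_le hline
    have hmim := lt_abs_im_of_doubleXi_eq_zero (doubleXi_eq_zero_of_mem_zetaZeros hm.1)
      (by linarith : m.re < 1 / 2).ne
    rw [abs_of_nonneg (mem_zetaZeros_iff.1 hm.1).1.2] at hmim
    have hne : m ≠ k := by
      rintro rfl
      have : m.im ≤ t := by simpa using hkim
      linarith
    exact (Set.encard_pair hne).symm.le.trans
      (Set.encard_le_encard (Set.insert_subset hm (Set.singleton_subset_iff.2 hk)))
  · intro h hRH
    have hsub : minimalZetaZeros.Subsingleton := by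
      have hre : ∀ s ∈ minimalZetaZeros, s.re = 1 / 2 := by
        intro s hs
        have hz := hs.1
        have h1 := riemannZeta_eq_zero_of_doubleXi_eq_zero (doubleXi_eq_zero_of_mem_zetaZeros hz)
        refine hRH s h1.1 ?_ (fun h => ?_)
        · rintro ⟨n, rfl⟩
          have h2 := h1.2.1
          have e : (-2 * ((n : ℂ) + 1)) = ((-2 * ((n : ℝ) + 1) : ℝ) : ℂ) := by push_cast; ring
          rw [e, ofReal_re] at h2
          linarith [(Nat.cast_nonneg n : (0 : ℝ) ≤ n)]
        · rw [h, one_re] at h1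
          linarith [h1.2.2]
      intro s hs w hw
      have hs2 := hre s hs
      have hw2 := hre w hw
      rcases le_total s.im w.im with h | h
      · have := hw.2 hs.1 ⟨by linarith, h⟩
        exact Complex.ext (by linarith) (le_antisymm h this.2)
      · have := hs.2 hw.1 ⟨by linarith, h⟩
        exact Complex.ext (by linarith) (le_antisymm this.2 h)
    have := Set.encard_le_one_iff_subsingleton.2 hsub
    exact absurd (h.trans this) (by norm_num)
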